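/- **Model.** An input graph is a finite simple connected undirected graph $G=(V,E)$, $|V|=n\ge 1$, in which the edges incident to each node $v$ carry distinct port numbers $0,\dots,\Delta(v)-1$ (the two numbers of an edge are independent). Nodes are anonymous. Each node $v$ has a storage $b(v)$, and the single agent has a memory; both are bit strings that initially contain only zeros. In one agent step the agent, located at $v$, runs a fixed deterministic five-tape Turing machine with finitely many states, tape alphabet $\{0,1,\sqcup\}$ and transition function giving the new state, the written symbols and a move left or right of every head. The first two tapes hold the memory and $b(v)$; the third and fourth, read-only, hold in unary the degree of $v$ and the port by which the agent entered $v$ (port $p$ is written as $p+1$ ones, the empty tape standing for "no port" at the start); the fifth, write-only, is initially blank. The machine starts in its initial state with its heads at the beginning of the tapes, so between agent steps only the memory and the storages persist. When it terminates with a port $p<\Delta(v)$ on the fifth tape, the agent moves through that port; when it terminates with a blank fifth tape, the execution ends. The memory complexity is at most $g$, respectively the storage complexity at most $h$, if in all executions on graphs with at most $n$ nodes the machine uses at most $g(n)$ bits of the first tape, respectively $h(n)$ bits of the second tape. The algorithm is polynomial-time if on graphs with $n$ nodes it always terminates after polynomially many agent steps and each local computation takes polynomially many Turing machine steps. A decision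 task is a set $\mathcal T$ of input graphs. An algorithm solves $\mathcal T$ if for every input graph $G$ and every initial location the agent terminates, and the output register (the first bit of the storage) of its final location then contains the truth value of $G\in\mathcal T$. Let $\mathsf{P_{AGT}}(g(n),h(n))$ be the class of the decision tasks solved by a polynomial-time algorithm of memory complexity at most $g(n)$ and storage complexity at most $h(n)$, and let $\mathsf{P_{AGT}}(g(n),\Theta(1))=\bigcup_{h=\Theta(1)}\mathsf{P_{AGT}}(g(n),h(n))$. **Theorem.** Let $\mathsf{Parity}$ be the decision task consisting of all input graphs with an odd number of nodes. Then $\mathsf{Parity}\in\mathsf{P_{AGT}}(1,\Theta(1))$ and $\mathsf{Parity}\notin\mathsf{P_{AGT}}(0,\Theta(1))$. Consequently $\mathsf{P_{AGT}}(0,\Theta(1))\subsetneq\mathsf{P_{AGT}}(1,\Theta(1))$. -/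

import Mathlib

namespace MobileAgent

/-! ### Input graphs -/

/-- An input graph: a finite simple connected (in particular nonempty) undirected graph together
with a port numbering, i.e. for every node `v` a bijection `port v` from the neighbours of `v`
(equivalently the edges incident to `v`) to `{0, …, deg v - 1}`. The numberings at the two
endpoints of an edge are independent of each other. -/
structure PortGraph where
  V : Type
  [fintypeV : Fintype V]
  [decEqV : DecidableEq V]
  graph : SimpleGraph V
  [decAdj : DecidableRel graph.Adj]
  connected : graph.Connected
  port : ∀ v : V, graph.neighborSet v ≃ Fin (graph.degree v)

attribute [instance] PortGraph.fintypeV PortGraph.decEqV PortGraph.decAdj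

/-- The number `n` of nodes. -/
def PortGraph.order (G : PortGraph) : ℕ := Fintype.card G.V

/-- The neighbour of `v` reached through port `p` of `v`. -/
def PortGraph.dest (G : PortGraph) (v : G.V) (p : Fin (G.graph.degree v)) : G.V :=
  ((G.port v).symm p : G.V)

/-- The port by which an agent that leaves `v` through port `p` enters the neighbour
`G.dest v p`. -/
def PortGraph.entry (G : PortGraph) (v : G.V) (p : Fin (G.graph.degree v)) :
    Fin (G.graph.degree (G.dest v p)) :=
  G.port (G.dest v p) ⟨v, SimpleGraph.Adj.symm ((G.port v).symm p).2⟩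

/-! ### Tapes and machines -/

/-- The tape alphabet `{0, 1, ⊔}`: `some false` is `0`, `some true` is `1`, `none` is `⊔`. -/
abbrev TapeSymbol := Option Bool

/-- The contents of a tape that is infinite in both directions. -/
abbrev TapeContents := ℤ → TapeSymbol

/-- The empty tape. -/
def blankTape : TapeContents := fun _ => none

/-- The tape that holds `1 ⋯ 1` (`k` times) in the cells `0, …, k - 1` and is blank elsewhere. -/
def unaryTape (k : ℕ) : TapeContents := fun i => if 0 ≤ i ∧ i < k then some true else none

/-- The initial contents of the memory and of every storage: zeros, starting in cell `0`. The
string is padded with zeros to the right, so that its initial contents carry no information;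
how many of the cells are used is measured by `UsesAtMost`. -/
def zeroTape : TapeContents := fun i => if 0 ≤ i then some false else none

/-- The tape of the agent's persistent memory. -/
abbrev memTape : Fin 5 := 0
/-- The tape of the storage at the current node. -/
abbrev stoTape : Fin 5 := 1
/-- The tape with the degree of the current node. -/
abbrev degTape : Fin 5 := 2
/-- The tape with the port by which the agent entered the current node. -/
abbrev inTape : Fin 5 := 3
/-- The tape on which the port of the next move is written. -/
abbrev outTape : Fin 5 := 4

/-- An algorithm: a five-tape Turing machine with finitely many states `Q`, initial state `q₀`,
termination state `q₁` and transition function `γ`, which maps the state and the five scanned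
symbols to the new state, the five symbols written and the five head movements. The degree tape
and the entry-port tape are read-only; the output tape is write-only. -/
structure Algorithm where
  Q : Type
  [fintypeQ : Fintype Q]
  [decEqQ : DecidableEq Q]
  q₀ : Q
  q₁ : Q
  γ : Q → (Fin 5 → TapeSymbol) → Q × (Fin 5 → TapeSymbol) × (Fin 5 → Turing.Dir)
  deg_readOnly : ∀ q s, (γ q s).2.1 degTape = s degTape
  in_readOnly : ∀ q s, (γ q s).2.1 inTape = s inTape
  out_writeOnly : ∀ q s s', (∀ i, i ≠ outTape → s i = s' i) → γ q s = γ q s'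

attribute [instance] Algorithm.fintypeQ Algorithm.decEqQ

/-- A configuration of the Turing machine: state, tape contents, head positions. -/
structure TMConfig (A : Algorithm) where
  state : A.Q
  tape : Fin 5 → TapeContents
  head : Fin 5 → ℤ

/-- The new position of a head. -/
def moveHead (d : Turing.Dir) (i : ℤ) : ℤ :=
  match d with
  | Turing.Dir.left => i - 1
  | Turing.Dir.right => i + 1

/-- One TM step. A configuration in the termination state does not change any more. -/
def Algorithm.tmStep (A : Algorithm) (c : TMConfig A) : TMConfig A :=
  if c.state = A.q₁ then c
  else
    let a := A.γ c.state (fun j => c.tape j (c.head j))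
    { state := a.1
      tape := fun j => Function.update (c.tape j) (c.head j) (a.2.1 j)
      head := fun j => moveHead (a.2.2 j) (c.head j) }

/-- The tape holds a bit string of length `ℓ` (followed by the zeros of `zeroTape`), and its head
is on that string or on one of the two cells next to it. -/
def UsesAtMost (ℓ : ℕ) (t : TapeContents) (head : ℤ) : Prop :=
  (∀ i : ℤ, 0 ≤ i → i < ℓ → t i ≠ none) ∧
  (∀ i : ℤ, (i < 0 ∨ (ℓ : ℤ) ≤ i) → t i = zeroTape i) ∧
  -1 ≤ head ∧ head ≤ ℓ

/-! ### Executions of the agent -/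

/-- A configuration at the beginning of an agent step: the current node, the port by which the
agent entered it (`none` at the beginning of the execution), the contents of the memory and the
contents of the storages of all nodes. -/
structure AgentConfig (G : PortGraph) where
  loc : G.V
  inPort : Option ℕ
  mem : TapeContents
  sto : G.V → TapeContents

/-- The initial configuration with initial location `v`. -/
def AgentConfig.start (G : PortGraph) (v : G.V) : AgentConfig G where
  loc := v
  inPort := none
  mem := zeroTape
  sto := fun _ => zeroTape

/-- The unary encoding of a port number or of its absence. Port `p` is written as `p + 1` ones,
so that port `0` differs from the empty tape, which stands for no port. -/
def portTape : Option ℕ → TapeContents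
  | none => blankTape
  | some p => unaryTape (p + 1)

/-- The initial TM configuration of the local computation in an agent step. Besides the storage
at the current node, only the contents of the memory tape survive from the preceding agent steps:
the state and the head positions are reset. -/
def Algorithm.localInit (A : Algorithm) {G : PortGraph} (c : AgentConfig G) : TMConfig A where
  state := A.q₀
  tape := ![c.mem, c.sto c.loc, unaryTape (G.graph.degree c.loc), portTape c.inPort, blankTape]
  head := fun _ => 0

/-- The TM configuration after `t` TM steps of the local computation. -/
def Algorithm.localRun (A : Algorithm) {G : PortGraph} (c : AgentConfig G) (t : ℕ) : TMConfig A :=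
  A.tmStep^[t] (A.localInit c)

/-- The local computation started in `c` terminates with the TM configuration `r`. -/
def Algorithm.LocalResult (A : Algorithm) {G : PortGraph} (c : AgentConfig G) (r : TMConfig A) :
    Prop :=
  ∃ t : ℕ, A.localRun c t = r ∧ r.state = A.q₁

/-- One agent step from `c` to `c'` that ends with a movement: the local computation terminates
with a port `p` of the current node on the output tape, its storage tape is left in the storage
of the current node, and the agent moves through port `p`. -/
def Algorithm.Move (A : Algorithm) {G : PortGraph} (c c' : AgentConfig G) : Prop :=
  ∃ r : TMConfig A, A.LocalResult c r ∧
    ∃ p : Fin (G.graph.degree c.loc),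
      r.tape outTape = portTape (some p) ∧
      c' = { loc := G.dest c.loc p
             inPort := some (G.entry c.loc p)
             mem := r.tape memTape
             sto := Function.update c.sto c.loc (r.tape stoTape) }

/-- The algorithm terminates in the agent step started in `c`: the local computation terminates,
with TM configuration `r`, and nothing is written on the output tape. -/
def Algorithm.Stop (A : Algorithm) {G : PortGraph} (c : AgentConfig G) (r : TMConfig A) : Prop :=
  A.LocalResult c r ∧ r.tape outTape = blankTape

/-- `c` is the configuration after `k` agent steps of the execution with initial location `v`. -/
def Algorithm.ReachesIn (A : Algorithm) (G : PortGraph) (v : G.V) : ℕ → AgentConfig G → Prop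
  | 0, c => c = AgentConfig.start G v
  | k + 1, c' => ∃ c, A.ReachesIn G v k c ∧ A.Move c c'

/-! ### Decision tasks and complexity classes -/

/-- A decision task: the set of its yes-instances. -/
abbrev DecisionTask := Set PortGraph

/-- The algorithm solves the task: for every input graph and every initial location the agent
terminates, with the value of the predicate `G ∈ T` in the output register (cell `0` of the
storage) at the final location. -/
def Algorithm.Solves (A : Algorithm) (T : DecisionTask) : Prop :=
  ∀ (G : PortGraph) (v : G.V), ∃ (k : ℕ) (c : AgentConfig G) (r : TMConfig A),
    A.ReachesIn G v k c ∧ A.Stop c r ∧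
    (G ∈ T → r.tape stoTape 0 = some true) ∧ (G ∉ T → r.tape stoTape 0 = some false)

/-- A polynomial-time algorithm: on graphs with `n` nodes it terminates within polynomially many
(in `n`) agent steps, and the local computation in every agent step terminates within polynomially
many TM steps. -/
def Algorithm.PolyTime (A : Algorithm) : Prop :=
  ∃ P : Polynomial ℕ, ∀ (G : PortGraph) (v : G.V),
    (∃ k ≤ P.eval G.order, ∃ (c : AgentConfig G) (r : TMConfig A),
      A.ReachesIn G v k c ∧ A.Stop c r) ∧
    (∀ (k : ℕ) (c : AgentConfig G), A.ReachesIn G v k c →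
      ∃ t ≤ P.eval G.order, (A.localRun c t).state = A.q₁)

/-- Tape `j` has length at most `f n` in all executions on graphs with at most `n` nodes. -/
def Algorithm.TapeBound (A : Algorithm) (j : Fin 5) (f : ℕ → ℕ) : Prop :=
  ∀ (n : ℕ) (G : PortGraph), G.order ≤ n → ∀ (v : G.V) (k : ℕ) (c : AgentConfig G),
    A.ReachesIn G v k c →
      ∀ t : ℕ, UsesAtMost (f n) ((A.localRun c t).tape j) ((A.localRun c t).head j)

/-- The class `P_AGT(g(n), h(n))` of the decision tasks that are solvable by a polynomial-time
algorithm with `g(n)`-bit memory and `h(n)`-bit storage. -/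
def PAGT (g h : ℕ → ℕ) : Set DecisionTask :=
  {T | ∃ A : Algorithm, A.Solves T ∧ A.PolyTime ∧ A.TapeBound memTape g ∧ A.TapeBound stoTape h}

/-- The class `P_AGT(g(n), Θ(h(n)))`: the union of `P_AGT(g(n), h'(n))` over all
`h'(n) = Θ(h(n))`. -/
def PAGTTheta (g h : ℕ → ℕ) : Set DecisionTask :=
  ⋃ h' ∈ {h' : ℕ → ℕ | Asymptotics.IsTheta Filter.atTop
    (fun n => (h' n : ℝ)) (fun n => (h n : ℝ))}, PAGT g h'

/-- The task `Parity`: the graphs with an odd number of nodes. -/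
def Parity : DecisionTask := {G | Odd G.order}

end MobileAgent

namespace MobileAgent

/-! ### Finite controllers -/

/-! Upper bound. An agent with finite memory can search the graph depth-first while it carries the
parity of the number of visited nodes. The difficulty is backtracking, since a node with bounded
storage cannot record the port that leads to its predecessor. The search therefore keeps its current
path induced: a new neighbour is appended only if none of its neighbours except the last node lies
on the path. The predecessor of the last node is then its only active neighbour and can be found by
asking around. Rejections lose no node. A rejected node has a neighbour on the path before the last
node, so every neighbour of a finished node is visited or adjacent to a node of the path as it was
before the exploration (`dfs.Explored.nbr`). When only the root is on the path, nothing can be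
rejected, so all neighbours of the root get visited; by connectedness, so do all nodes
(`dfs.exploresUpTo`, `dfs.exists_steps_of_degree_pos`). Finite memory reduces to one bit by sending
each message in unary, with round trips over a single edge (`Controller.mem_PAGTTheta`), and the
resulting controller runs on a Turing machine (`Controller.mem_PAGT`).

Lower bound. An agent without memory starts at the upper end of the path `0, …, m`. It can return to
a node only over the edge by which it left, so its successive moves at a node form a fixed word that
depends only on the kind of the node: lower end, inner node or start. Hence the answer depends only
on the kind of the node where the agent halts, and this kind has to change whenever `m` grows by
one. Let `entries i` be the number of the entry from above into `0, …, i` after which the agent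
halts there. Since `entries (i + 1)` is a fixed monotone function of `entries i`, the sequence is
monotone or antitone. The agent halts at the start exactly when a constant is less than `entries (m
- 1)`, so doing this for one of the lengths `2, 3, 4` forces it for two consecutive lengths.
Otherwise it halts elsewhere for all three of them; as a halt at an inner node excludes a halt at
node `0` on longer paths, two consecutive lengths again have the same kind (`not_forall_end_kind`).
-/

/-- The length of the unary encoding of an entry port. -/
def portLen : Option ℕ → ℕ
  | none => 0
  | some p => p + 1

lemma portTape_eq (x : Option ℕ) : portTape x = unaryTape (portLen x) := by
  cases x with
  | none =>
    funext i
    have : ¬ (0 ≤ i ∧ i < ((0 : ℕ) : ℤ)) := by push_cast; omega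
    exact (if_neg this).symm
  | some p => rfl

lemma unaryTape_injective : Function.Injective unaryTape := by
  intro a b h
  by_contra hne
  wlog hlt : a < b generalizing a b
  · exact this h.symm (Ne.symm hne) (by omega)
  have := congrFun h (a : ℤ)
  simp [unaryTape, hlt] at this

lemma blankTape_eq : blankTape = unaryTape 0 := portTape_eq none

/-- A finite control for an agent with memory `M` and storages `S`. The transition function sees
the memory, the storage, whether there is an entry port, and whether the port after the entry port
(port `0`, if there is no entry port) exists. The unary encoding of the exit port consists of a
copy of the encoding of the entry port (first Boolean) and of an extra one (second Boolean). -/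
structure Controller (M S : Type) where
  mem₀ : M
  sto₀ : S
  -- Since port `p` is written as `p + 1` ones, a copy alone sends the agent back, the extra one
  -- alone means port `0`, both mean the port after the entry port, and neither ends the execution.
  δ : M → S → Bool → Bool → M × S × Bool × Bool

/-- The length of the unary encoding of the exit port. -/
def outLen (copy extra : Bool) (l : ℕ) : ℕ := (bif copy then l else 0) + (bif extra then 1 else 0)

namespace Controller

variable {M S : Type} {G : PortGraph}

/-- A configuration of a controlled agent. -/
structure Config (G : PortGraph) (M S : Type) where
  loc : G.V
  inPort : Option ℕ
  mem : M
  sto : G.V → S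

/-- The initial configuration. -/
def start (C : Controller M S) (G : PortGraph) (v : G.V) : Config G M S :=
  ⟨v, none, C.mem₀, fun _ => C.sto₀⟩

/-- The value of the transition function in a configuration. -/
def act (C : Controller M S) (c : Config G M S) : M × S × Bool × Bool :=
  C.δ c.mem (c.sto c.loc) c.inPort.isSome (decide (portLen c.inPort < G.graph.degree c.loc))

/-- The length of the unary encoding of the exit port in a configuration. -/
def exitLen (C : Controller M S) (c : Config G M S) : ℕ :=
  outLen (C.act c).2.2.1 (C.act c).2.2.2 (portLen c.inPort)

/-- A step that ends with a movement. -/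
def Move (C : Controller M S) (c c' : Config G M S) : Prop :=
  ∃ p : Fin (G.graph.degree c.loc), C.exitLen c = p + 1 ∧
    c' = ⟨G.dest c.loc p, some (G.entry c.loc p), (C.act c).1,
      Function.update c.sto c.loc (C.act c).2.1⟩

/-- `k` consecutive movements. -/
def Steps (C : Controller M S) : ℕ → Config G M S → Config G M S → Prop
  | 0, c, c' => c = c'
  | k + 1, c, c' => ∃ d, C.Steps k c d ∧ C.Move d c'

lemma Steps.trans {C : Controller M S} {k l : ℕ} {a b c : Config G M S}
    (h₁ : C.Steps k a b) (h₂ : C.Steps l b c) : C.Steps (k + l) a c := by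
  induction l generalizing c with
  | zero => cases h₂; exact h₁
  | succ l ih =>
    obtain ⟨d, hd, hm⟩ := h₂
    exact ⟨d, ih hd, hm⟩

lemma Move.steps {C : Controller M S} {a b : Config G M S} (h : C.Move a b) : C.Steps 1 a b :=
  ⟨a, rfl, h⟩

end Controller

/-! ### Tapes with bit strings -/

/-- The tape with the bits `f 0, f 1, …` in the cells `0, 1, …`. -/
def strTape (f : ℕ → Bool) : TapeContents := fun i => if 0 ≤ i then some (f i.toNat) else none

@[simp] lemma strTape_natCast (f : ℕ → Bool) (n : ℕ) : strTape f (n : ℤ) = some (f n) := by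
  simp [strTape]

lemma strTape_update (f : ℕ → Bool) (n : ℕ) (b : Bool) :
    Function.update (strTape f) (n : ℤ) (some b) = strTape (Function.update f n b) := by
  funext i
  by_cases h : 0 ≤ i
  · obtain ⟨k, rfl⟩ := Int.eq_ofNat_of_zero_le h
    by_cases hk : k = n
    · subst hk; simp
    · have : (k : ℤ) ≠ n := by exact_mod_cast hk
      simp [Function.update_of_ne this, Function.update_of_ne hk]
  · have : i ≠ n := by omega
    simp [Function.update_of_ne this, strTape, h]

lemma usesAtMost_strTape {l : ℕ} {f : ℕ → Bool} {x : ℤ} (hf : ∀ i, l ≤ i → f i = false)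
    (h₁ : -1 ≤ x) (h₂ : x ≤ l) : UsesAtMost l (strTape f) x := by
  refine ⟨fun i hi _ => by simp [strTape, hi], fun i hi => ?_, h₁, h₂⟩
  rcases hi with hi | hi
  · simp [strTape, zeroTape, not_le.mpr hi]
  · have h0 : 0 ≤ i := le_trans (by positivity) hi
    simp [strTape, zeroTape, h0, hf i.toNat (by omega)]

/-- The bit string of a one-bit memory. -/
def memBits (m : Bool) : ℕ → Bool := fun i => bif i = 0 then m else false

lemma unaryTape_lt {l i : ℕ} (h : i < l) : unaryTape l (i : ℤ) = some true := by
  simp [unaryTape, h]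

lemma unaryTape_self (l : ℕ) : unaryTape l (l : ℤ) = none := by
  simp [unaryTape]

lemma unaryTape_neg_one (l : ℕ) : unaryTape l (-1) = none := by
  simp [unaryTape]

lemma unaryTape_update (l : ℕ) :
    Function.update (unaryTape l) (l : ℤ) (some true) = unaryTape (l + 1) := by
  funext i
  by_cases h : i = l
  · subst h; simp [unaryTape]
  · rw [Function.update_of_ne h]
    unfold unaryTape
    have : (0 ≤ i ∧ i < (l : ℤ)) ↔ (0 ≤ i ∧ i < ((l + 1 : ℕ) : ℤ)) := by push_cast; omega
    simp only [this]

lemma blankTape_update (x : ℤ) : Function.update blankTape x none = blankTape :=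
  Function.update_eq_self (f := blankTape) x

/-! ### Implementation of a controller with one bit of memory on a Turing machine -/

namespace Controller

section Compile

/-! ### Encoding of finite storages by bit strings -/

variable {S : Type} [Fintype S]

/-- The cell that marks the storage value `s`. -/
noncomputable def idx (s : S) : ℕ := Fintype.equivFin S s + 1

lemma idx_injective : Function.Injective (idx : S → ℕ) := fun a b h => by
  simpa [idx, Fin.val_inj] using h

lemma idx_lt (s : S) : idx s < Fintype.card S + 1 := by
  simp [idx]

open Classical in
/-- The encoding of storage values by bit strings, with the output bit in cell `0`. -/
noncomputable def enc (C : Controller Bool S) (out : S → Bool) (s : S) : ℕ → Bool := fun i =>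
  -- The initial value leaves no mark, because untouched storages consist of zeros.
  if i = 0 then out s else decide (s ≠ C.sto₀ ∧ idx s = i)

variable (S) in
/-- The number of storage bits. -/
abbrev width : ℕ := Fintype.card S + 1

lemma enc_eq_false (C : Controller Bool S) (out : S → Bool) (s : S) {i : ℕ} (h : width S ≤ i) :
    enc C out s i = false := by
  have h0 : i ≠ 0 := by unfold width at h; omega
  have := idx_lt s
  simp only [enc, if_neg h0, decide_eq_false_iff_not]
  rintro ⟨-, h'⟩
  unfold width at h
  omega

open Classical in
/-- The update of the candidate for the storage value when cell `k` is read. -/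
noncomputable def readCell (k : ℕ) (cand : S) (b : TapeSymbol) : S :=
  if h : ∃ s : S, b = some true ∧ idx s = k then h.choose else cand

/-- The candidate for the storage value `s` after `k` cells have been read. -/
noncomputable def candidate (C : Controller Bool S) (s : S) (k : ℕ) : S :=
  if idx s < k then s else C.sto₀

/-- Beyond cell `0` there is at most one mark, so a scan only has to keep `C.sto₀` until it meets
the mark. -/
lemma readCell_candidate (C : Controller Bool S) (out : S → Bool) (s : S) (k : ℕ) :
    readCell k (candidate C s k) (some (enc C out s k)) = candidate C s (k + 1) := by
  unfold readCell
  split_ifs with h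
  · obtain ⟨hb, hk⟩ := h.choose_spec
    have h0 : k ≠ 0 := by rw [← hk]; simp [idx]
    have hb' : s ≠ C.sto₀ ∧ idx s = k := by simpa [enc, h0] using hb
    have : h.choose = s := idx_injective (hk.trans hb'.2.symm)
    rw [this, candidate, if_pos (by omega)]
  · by_cases hk : idx s = k
    · have h0 : k ≠ 0 := by rw [← hk]; simp [idx]
      have : s = C.sto₀ := by
        by_contra hne
        exact h ⟨s, by simp [enc, h0, hne, hk], hk⟩
      simp [candidate, this]
    · have : (idx s < k + 1) = (idx s < k) := by simp only [eq_iff_iff]; omega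
      simp [candidate, this]

/-! ### The Turing machine -/

variable (S) in
/-- A counter value. -/
def clip (k : ℕ) : Fin (width S + 1) := ⟨min k (width S), by omega⟩

lemma clip_val {k : ℕ} (h : k ≤ width S) : (clip S k : ℕ) = k := min_eq_left h

variable (S) in
/-- The phases of the local computation. -/
inductive Phase
  | scan (hasIn : Bool)
  | back (hasIn more : Bool)
  | read (hasIn more mem : Bool) (k : Fin (width S + 1)) (cand : S)
  | write (mem : Bool) (s : S) (copy extra : Bool) (k : Fin (width S + 1))
  | turn (copy extra : Bool)
  | emit (copy extra : Bool)

instance : Finite (Phase S) := by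
  let f : Phase S → Bool ⊕ (Bool × Bool) ⊕ (Bool × Bool × Bool × Fin (width S + 1) × S) ⊕
      (Bool × S × Bool × Bool × Fin (width S + 1)) ⊕ (Bool × Bool) ⊕ (Bool × Bool) := fun q =>
    match q with
    | .scan a => .inl a
    | .back a b => .inr (.inl (a, b))
    | .read a b c d e => .inr (.inr (.inl (a, b, c, d, e)))
    | .write a b c d e => .inr (.inr (.inr (.inl (a, b, c, d, e))))
    | .turn a b => .inr (.inr (.inr (.inr (.inl (a, b)))))
    | .emit a b => .inr (.inr (.inr (.inr (.inr (a, b)))))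
  refine Finite.of_injective f fun a b h => ?_
  cases a <;> cases b <;> simp_all [f]

/-- The direction of a head that alternates between the cells `0` and `1`. -/
def osc (p : Bool) : Turing.Dir := bif p then .left else .right

/-- The position of a head that alternates between the cells `0` and `1`. -/
def oscPos (p : Bool) : ℤ := bif p then 1 else 0

lemma moveHead_osc (p : Bool) : moveHead (osc p) (oscPos p) = oscPos (!p) := by
  cases p <;> rfl

open Turing.Dir in
/-- The transition function of the Turing machine. -/
noncomputable def trans (C : Controller Bool S) (out : S → Bool) (q : Option (Bool × Phase S))
    (s : Fin 5 → TapeSymbol) :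
    Option (Bool × Phase S) × (Fin 5 → TapeSymbol) × (Fin 5 → Turing.Dir) :=
  match q with
  | none => (none, ![s 0, s 1, s 2, s 3, none], ![right, right, right, right, right])
  -- Every head moves in every step, and one bit of memory confines its head to the cells `-1, 0,
  -- 1`. That head alternates between `0` and `1`; `p` records its position.
  | some (p, .scan h) =>
    if s 3 = some true then
      (some (!p, .scan true), ![s 0, s 1, s 2, s 3, none], ![osc p, osc p, right, right, right])
    else
      (some (!p, .back h (decide (s 2 = some true))), ![s 0, s 1, s 2, s 3, none],
        ![osc p, osc p, left, left, left])
  | some (p, .back h m) =>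
    if s 3 = some true then
      (some (!p, .back h m), ![s 0, s 1, s 2, s 3, none], ![osc p, osc p, left, left, left])
    else
      (some (!p, .read h m false (clip S 0) C.sto₀), ![s 0, s 1, s 2, s 3, none],
        ![osc p, osc p, right, right, right])
  | some (p, .read h m b k c) =>
    if (k : ℕ) < width S then
      -- The memory bit is under its head only when `p` is false, which holds for `k = 0`.
      (some (!p, .read h m (bif p then b else decide (s 0 = some true)) (clip S (k + 1))
        (readCell k c (s 1))), ![s 0, s 1, s 2, s 3, none], ![osc p, right, left, left, left])
    else
      let r := C.δ b c h m
      (some (!p, .write r.1 r.2.1 r.2.2.1 r.2.2.2 (clip S (width S - 1))),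
        ![s 0, s 1, s 2, s 3, none], ![osc p, left, right, right, right])
  | some (p, .write m s' cp ex k) =>
    -- In a run, `p` is the parity of `k`, so both the storage head and the memory head are on cell
    -- `0` here.
    if (k : ℕ) = 0 then
      (some (!p, .turn cp ex), ![some m, some (enc C out s' 0), s 2, s 3, none],
        ![osc p, right, right, right, right])
    else
      (some (!p, .write m s' cp ex (clip S (k - 1))),
        ![s 0, some (enc C out s' k), s 2, s 3, none], ![osc p, left, right, right, right])
  | some (p, .turn cp ex) =>
    -- The last write has left all heads on cell `1`; this step brings them back to cell `0`.
    (some (!p, .emit cp ex), ![s 0, s 1, s 2, s 3, none], ![osc p, left, left, left, left])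
  | some (p, .emit cp ex) =>
    if cp = true ∧ s 3 = some true then
      (some (!p, .emit cp ex), ![s 0, s 1, s 2, s 3, some true],
        ![osc p, osc p, right, right, right])
    else
      (none, ![s 0, s 1, s 2, s 3, bif ex then some true else none],
        ![osc p, osc p, right, right, right])

open Classical in
/-- The Turing machine that implements a controller with one bit of memory. -/
noncomputable def toAlgorithm (C : Controller Bool S) (out : S → Bool) : Algorithm where
  Q := Option (Bool × Phase S)
  fintypeQ := Fintype.ofFinite _
  q₀ := some (false, .scan false)
  q₁ := none
  γ := trans C out
  deg_readOnly q s := by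
    rcases q with - | ⟨p, q⟩
    · rfl
    cases q <;> simp only [trans] <;> (try split_ifs) <;> rfl
  in_readOnly q s := by
    rcases q with - | ⟨p, q⟩
    · rfl
    cases q <;> simp only [trans] <;> (try split_ifs) <;> rfl
  out_writeOnly q s s' h := by
    have h0 := h 0 (by decide)
    have h1 := h 1 (by decide)
    have h2 := h 2 (by decide)
    have h3 := h 3 (by decide)
    rcases q with - | ⟨p, q⟩
    · simp only [trans, h0, h1, h2, h3]
    cases q <;> simp only [trans, h0, h1, h2, h3]

/-! ### Runs within the space bounds -/

variable (C : Controller Bool S) (out : S → Bool)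

/-- A Turing machine configuration in which the heads of the tapes for the degree, the entry port
and the exit port are in the same position `x`. -/
def cfg (q : Option (Bool × Phase S)) (m s d e o : TapeContents) (hm hs x : ℤ) :
    TMConfig (toAlgorithm C out) :=
  ⟨q, ![m, s, d, e, o], ![hm, hs, x, x, x]⟩

variable {C out}

lemma tmStep_cfg {q : Bool × Phase S} {m s d e o : TapeContents} {hm hs x : ℤ}
    {q' : Option (Bool × Phase S)} {w₀ w₁ w₄ : TapeSymbol} {d₀ d₁ d₂ : Turing.Dir}
    (h : trans C out (some q) ![m hm, s hs, d x, e x, o x] =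
      (q', ![w₀, w₁, d x, e x, w₄], ![d₀, d₁, d₂, d₂, d₂])) :
    (toAlgorithm C out).tmStep (cfg C out (some q) m s d e o hm hs x) =
      cfg C out q' (Function.update m hm w₀) (Function.update s hs w₁) d e (Function.update o x w₄)
        (moveHead d₀ hm) (moveHead d₁ hs) (moveHead d₂ x) := by
  have hs' : (fun j => (![m, s, d, e, o] : Fin 5 → TapeContents) j
      ((![hm, hs, x, x, x] : Fin 5 → ℤ) j)) = ![m hm, s hs, d x, e x, o x] := by
    funext j; fin_cases j <;> rfl
  unfold Algorithm.tmStep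
  rw [if_neg (by simp [cfg, toAlgorithm])]
  simp only [cfg]
  rw [hs']
  simp only [toAlgorithm]
  rw [h]
  congr 1
  · funext j; fin_cases j <;> simp
  · funext j; fin_cases j <;> rfl

/-- The bounds on the memory and on the storage. -/
def Bounded (c : TMConfig (toAlgorithm C out)) : Prop :=
  UsesAtMost 1 (c.tape memTape) (c.head memTape) ∧
    UsesAtMost (width S) (c.tape stoTape) (c.head stoTape)

lemma bounded_cfg {q : Option (Bool × Phase S)} {p b : Bool} {f : ℕ → Bool}
    {d e o : TapeContents} {y x : ℤ} (hf : ∀ i, width S ≤ i → f i = false)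
    (h₁ : -1 ≤ y) (h₂ : y ≤ width S) :
    Bounded (cfg C out q (strTape (memBits b)) (strTape f) d e o (oscPos p) y x) := by
  constructor
  · refine usesAtMost_strTape (fun i hi => ?_) ?_ ?_
    · simp [memBits, Nat.one_le_iff_ne_zero.mp hi]
    · cases p <;> simp [cfg, oscPos]
    · cases p <;> simp [cfg, oscPos]
  · exact usesAtMost_strTape hf h₁ h₂

lemma oscPos_bounds (p : Bool) : -1 ≤ oscPos p ∧ oscPos p ≤ (width S : ℕ) := by
  cases p
  · simp only [oscPos, cond_false]; omega
  · simp [oscPos, width]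

/-- The run of `n` steps from `c` to `c'`, all of it within the space bounds. -/
def Run (n : ℕ) (c c' : TMConfig (toAlgorithm C out)) : Prop :=
  (toAlgorithm C out).tmStep^[n] c = c' ∧
    ∀ t ≤ n, Bounded ((toAlgorithm C out).tmStep^[t] c)

lemma Run.cons {n : ℕ} {c c₁ c' : TMConfig (toAlgorithm C out)} (hb : Bounded c)
    (h : (toAlgorithm C out).tmStep c = c₁) (hr : Run n c₁ c') : Run (n + 1) c c' := by
  subst h
  refine ⟨hr.1, fun t ht => ?_⟩
  cases t with
  | zero => exact hb
  | succ t => exact hr.2 t (by omega)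

variable (C out) in
/-- The result of the local computation. -/
def IsResult (l dg : ℕ) (r : Bool × S × Bool × Bool) (c : TMConfig (toAlgorithm C out)) : Prop :=
  ∃ p x, c = cfg C out none (strTape (memBits r.1)) (strTape (enc C out r.2.1)) (unaryTape dg)
    (unaryTape l) (unaryTape (outLen r.2.2.1 r.2.2.2 l)) (oscPos p) (oscPos p) x

variable (C out) in
/-- The computation from `c` ends after `n` steps, with the result `r`. -/
def Halts (l dg : ℕ) (r : Bool × S × Bool × Bool) (n : ℕ) (c : TMConfig (toAlgorithm C out)) :
    Prop :=
  ∃ c', IsResult C out l dg r c' ∧ Run n c c'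

lemma tmStep_cfg_eq {q : Phase S} {p : Bool} {m m' s s' d e o o' : TapeContents} {y y' x x' : ℤ}
    {q' : Option (Bool × Phase S)} (w₀ w₁ w₄ : TapeSymbol) (d₁ d₂ : Turing.Dir)
    (h : trans C out (some (p, q)) ![m (oscPos p), s y, d x, e x, o x] =
      (q', ![w₀, w₁, d x, e x, w₄], ![osc p, d₁, d₂, d₂, d₂]))
    (hm : Function.update m (oscPos p) w₀ = m') (hs : Function.update s y w₁ = s')
    (ho : Function.update o x w₄ = o') (hy : moveHead d₁ y = y') (hx : moveHead d₂ x = x') :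
    (toAlgorithm C out).tmStep (cfg C out (some (p, q)) m s d e o (oscPos p) y x) =
      cfg C out q' m' s' d e o' (oscPos !p) y' x' := by
  rw [tmStep_cfg h, hm, hs, ho, hy, hx, moveHead_osc]

lemma Halts.cons {l dg n : ℕ} {r : Bool × S × Bool × Bool} {c c₁ : TMConfig (toAlgorithm C out)}
    (hr : Halts C out l dg r n c₁) (hb : Bounded c) (h : (toAlgorithm C out).tmStep c = c₁) :
    Halts C out l dg r (n + 1) c := by
  obtain ⟨c', hc, hr⟩ := hr
  exact ⟨c', hc, Run.cons hb h hr⟩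

lemma halts_final (l dg : ℕ) (r : Bool × S × Bool × Bool) (p : Bool) (x : ℤ) :
    Halts C out l dg r 0 (cfg C out none (strTape (memBits r.1)) (strTape (enc C out r.2.1))
      (unaryTape dg) (unaryTape l) (unaryTape (outLen r.2.2.1 r.2.2.2 l)) (oscPos p) (oscPos p)
      x) := by
  refine ⟨_, ⟨p, x, rfl⟩, rfl, fun t ht => ?_⟩
  obtain rfl : t = 0 := by omega
  exact bounded_cfg (fun _ => enc_eq_false C out _) (oscPos_bounds (S := S) _).1 (oscPos_bounds (S := S) _).2

/-! ### The phases of the local computation, from the last to the first -/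

lemma halts_emit_copy (l dg : ℕ) (m : Bool) (s : S) (ex : Bool) : ∀ j i : ℕ, i + j = l →
    Halts C out l dg (m, s, true, ex) (j + 1) (cfg C out (some (i.bodd, .emit true ex))
      (strTape (memBits m)) (strTape (enc C out s)) (unaryTape dg) (unaryTape l) (unaryTape i)
      (oscPos i.bodd) (oscPos i.bodd) i) := by
  intro j
  induction j with
  | zero =>
    intro i hi
    obtain rfl : i = l := by omega
    refine (halts_final i dg (m, s, true, ex) (!i.bodd) (i + 1)).cons
      (bounded_cfg (fun _ => enc_eq_false C out s) (oscPos_bounds (S := S) _).1 (oscPos_bounds (S := S) _).2)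
      (tmStep_cfg_eq _ _ (bif ex then some true else none) (osc i.bodd) .right ?_
        (Function.update_eq_self _ _) (Function.update_eq_self _ _) ?_ (moveHead_osc _) rfl)
    · simp only [trans, Matrix.cons_val, unaryTape_self, reduceCtorEq, and_false, if_false]
    · cases ex
      · simp only [outLen, cond_true, cond_false, add_zero]
        rw [← unaryTape_self i]
        exact Function.update_eq_self _ _
      · exact unaryTape_update i
  | succ j ih =>
    intro i hi
    have := ih (i + 1) (by omega)
    rw [Nat.bodd_succ] at this
    refine this.cons
      (bounded_cfg (fun _ => enc_eq_false C out s) (oscPos_bounds (S := S) _).1 (oscPos_bounds (S := S) _).2)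
      (tmStep_cfg_eq _ _ (some true) (osc i.bodd) .right ?_
        (Function.update_eq_self _ _) (Function.update_eq_self _ _) (unaryTape_update i)
        (moveHead_osc _) (by simp [moveHead]))
    simp only [trans, Matrix.cons_val, unaryTape_lt (show i < l by omega), and_self, if_true]

lemma halts_emit (l dg : ℕ) (m : Bool) (s : S) (cp ex : Bool) :
    ∃ n ≤ l + 1, Halts C out l dg (m, s, cp, ex) n (cfg C out (some (false, .emit cp ex))
      (strTape (memBits m)) (strTape (enc C out s)) (unaryTape dg) (unaryTape l) blankTape
      0 0 0) := by
  cases cp with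
  | true =>
    refine ⟨l + 1, le_rfl, ?_⟩
    rw [blankTape_eq]
    exact halts_emit_copy l dg m s ex l 0 (zero_add l)
  | false =>
    refine ⟨1, by omega, (halts_final l dg (m, s, false, ex) true 1).cons
      (bounded_cfg (p := false) (y := 0) (fun _ => enc_eq_false C out s) (by omega) (by omega))
      (tmStep_cfg_eq (p := false) _ _ (bif ex then some true else none) .right .right ?_
        (Function.update_eq_self _ _) (Function.update_eq_self _ _) ?_ rfl rfl)⟩
    · simp [trans, osc]
    · cases ex
      · exact (blankTape_update 0).trans blankTape_eq
      · rw [blankTape_eq]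
        exact unaryTape_update 0

/-- The storage bits when the cells beyond `j` have been overwritten. -/
noncomputable def partialBits (C : Controller Bool S) (out : S → Bool) (s s' : S) (j : ℕ) :
    ℕ → Bool :=
  fun i => if j < i then enc C out s' i else enc C out s i

lemma partialBits_eq_false (s s' : S) (j : ℕ) {i : ℕ} (h : width S ≤ i) :
    partialBits C out s s' j i = false := by
  unfold partialBits
  split_ifs
  · exact enc_eq_false C out s' h
  · exact enc_eq_false C out s h

lemma partialBits_width (s s' : S) (j : ℕ) (h : width S ≤ j + 1) :
    partialBits C out s s' j = enc C out s := by
  funext i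
  unfold partialBits
  split_ifs with hi
  · rw [enc_eq_false C out s' (by omega), enc_eq_false C out s (by omega)]
  · rfl

lemma partialBits_update (s s' : S) (j : ℕ) :
    Function.update (partialBits C out s s' (j + 1)) (j + 1) (enc C out s' (j + 1)) =
      partialBits C out s s' j := by
  funext i
  by_cases hi : i = j + 1
  · subst hi; simp [partialBits]
  · rw [Function.update_of_ne hi]
    have : (j + 1 < i) = (j < i) := by simp only [eq_iff_iff]; omega
    simp only [partialBits, this]

lemma partialBits_update_zero (s s' : S) :
    Function.update (partialBits C out s s' 0) 0 (enc C out s' 0) = enc C out s' := by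
  funext i
  by_cases hi : i = 0
  · subst hi; simp
  · rw [Function.update_of_ne hi]
    simp [partialBits, Nat.pos_of_ne_zero hi]

lemma memBits_update (m m' : Bool) :
    Function.update (strTape (memBits m)) 0 (some m') = strTape (memBits m') := by
  have := strTape_update (memBits m) 0 m'
  rw [Nat.cast_zero] at this
  rw [this]
  congr 1
  funext i
  by_cases hi : i = 0
  · subst hi; simp [memBits]
  · simp [memBits, hi]

/-- Cells are overwritten from right to left. The common head of the other three tapes is at `-j`,
hence on cell `0` when the storage head gets there. -/
lemma halts_write (l dg : ℕ) (m m' : Bool) (s s' : S) (cp ex : Bool) :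
    ∃ n ≤ l + 3, ∀ j ≤ width S, Halts C out l dg (m', s', cp, ex) (n + j)
      (cfg C out (some (j.bodd, .write m' s' cp ex (clip S j))) (strTape (memBits m))
        (strTape (partialBits C out s s' j)) (unaryTape dg) (unaryTape l) blankTape
        (oscPos j.bodd) j (-j)) := by
  obtain ⟨n, hn, h⟩ := halts_emit (C := C) (out := out) l dg m' s' cp ex
  refine ⟨n + 2, by omega, fun j => ?_⟩
  induction j with
  | zero =>
    intro _
    have h₁ : Halts C out l dg (m', s', cp, ex) (n + 1) (cfg C out (some (true, .turn cp ex))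
        (strTape (memBits m')) (strTape (enc C out s')) (unaryTape dg) (unaryTape l) blankTape
        1 1 1) :=
      h.cons (bounded_cfg (p := true) (fun _ => enc_eq_false C out s') (by omega)
        (by simp [width]))
        (tmStep_cfg_eq (p := true) _ _ none .left .left (by simp [trans, osc])
          (Function.update_eq_self _ _) (Function.update_eq_self _ _) (blankTape_update 1) rfl rfl)
    refine h₁.cons (bounded_cfg (p := false) (fun _ => partialBits_eq_false s s' 0) (by omega)
      (by omega)) (tmStep_cfg_eq (p := false) (some m') (some (enc C out s' 0)) none .right .right
        ?_ (memBits_update m m') ?_ (blankTape_update _) rfl rfl)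
    · simp [trans, osc, clip]
    · rw [strTape_update, partialBits_update_zero]
  | succ j ih =>
    intro hj
    refine (ih (by omega)).cons (bounded_cfg (fun _ => partialBits_eq_false s s' _) (by omega)
      (by omega)) ?_
    have := tmStep_cfg_eq (C := C) (out := out) (q := .write m' s' cp ex (clip S (j + 1)))
      (p := (j + 1).bodd) (m := strTape (memBits m))
      (s := strTape (partialBits C out s s' (j + 1))) (d := unaryTape dg) (e := unaryTape l)
      (o := blankTape) (y := ((j + 1 : ℕ) : ℤ)) (x := -((j + 1 : ℕ) : ℤ))
      (q' := some (!(j + 1).bodd, .write m' s' cp ex (clip S j))) (y' := j) (x' := -j) _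
      (some (enc C out s' (j + 1))) none .left .right ?_
      (Function.update_eq_self _ _) (strTape_update _ _ _) (blankTape_update _)
      (by simp [moveHead]) (by simp [moveHead])
    · rw [this, partialBits_update, Nat.bodd_succ, Bool.not_not]
    · simp [trans, clip_val hj]

/-- The common head drifts to `-k` while the storage is read; the write phase undoes this drift. The
memory register holds the right bit as soon as `k > 0`. -/
lemma halts_read (l dg : ℕ) (h mo m : Bool) (s : S) :
    ∃ n ≤ l + 4 + width S, ∀ j k : ℕ, k + j = width S →
      Halts C out l dg (C.δ m s h mo) (n + j)
        (cfg C out (some (k.bodd, .read h mo (bif k = 0 then false else m) (clip S k)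
          (candidate C s k))) (strTape (memBits m)) (strTape (enc C out s)) (unaryTape dg)
          (unaryTape l) blankTape (oscPos k.bodd) k (-k)) := by
  obtain ⟨n, hn, H⟩ := halts_write (C := C) (out := out) l dg m (C.δ m s h mo).1 s
    (C.δ m s h mo).2.1 (C.δ m s h mo).2.2.1 (C.δ m s h mo).2.2.2
  have H := H (width S - 1) (by omega)
  refine ⟨n + (width S - 1) + 1, by omega, fun j => ?_⟩
  induction j with
  | zero =>
    intro k hk
    obtain rfl : k = width S := by omega
    -- Encodings vanish from cell `width S` on, so at `j = width S - 1` nothing has been overwritten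
    -- yet.
    rw [partialBits_width _ _ _ (by omega)] at H
    refine H.cons (bounded_cfg (fun _ => enc_eq_false C out s) (by omega) (by omega)) ?_
    have := tmStep_cfg_eq (C := C) (out := out) (q := .read h mo m (clip S (width S)) s)
      (p := (width S).bodd) (m := strTape (memBits m))
      (s := strTape (enc C out s)) (d := unaryTape dg) (e := unaryTape l)
      (o := blankTape) (y := ((width S : ℕ) : ℤ)) (x := -((width S : ℕ) : ℤ))
      (q' := some (!(width S).bodd, .write (C.δ m s h mo).1
        (C.δ m s h mo).2.1 (C.δ m s h mo).2.2.1 (C.δ m s h mo).2.2.2 (clip S (width S - 1))))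
      (y' := (width S - 1 : ℕ)) (x' := -(width S - 1 : ℕ)) _ _ none .left .right ?_
      (Function.update_eq_self _ _) (Function.update_eq_self _ _) (blankTape_update _)
      (by simp [moveHead]) (by simp [moveHead])
    · have hc : candidate C s (width S) = s := by simp [candidate, idx_lt s]
      simp only [hc]
      have hb : (!(width S).bodd) = (width S - 1).bodd := by
        simp [width]
      simpa [hb] using this
    · simp [trans, clip_val le_rfl]
  | succ j ih =>
    intro k hk
    have ih := ih (k + 1) (by omega)
    refine ih.cons (bounded_cfg (fun _ => enc_eq_false C out s) (by omega) (by omega)) ?_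
    rw [Nat.bodd_succ]
    refine tmStep_cfg_eq _ _ none .right .left ?_ (Function.update_eq_self _ _)
      (Function.update_eq_self _ _) (blankTape_update _) (by simp [moveHead])
      (by simp [moveHead]; ring)
    have hk' : k < width S := by omega
    have hm : (bif k.bodd then (bif k = 0 then false else m)
        else decide (strTape (memBits m) (oscPos k.bodd) = some true)) = m := by
      rcases hb : k.bodd with - | -
      · have := strTape_natCast (memBits m) 0
        simp only [Nat.cast_zero] at this
        simp [oscPos, this, memBits]
      · have : k ≠ 0 := by rintro rfl; simp at hb
        simp [this]
    simp only [trans, clip_val hk'.le, hk', if_true, Matrix.cons_val, strTape_natCast,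
      readCell_candidate]
    simp only [hm]
    simp

/-- The way back ends at cell `-1`, the blank to the left of the unary string. -/
lemma halts_back (l dg : ℕ) (h mo m : Bool) (s : S) :
    ∃ n ≤ l + 5 + 2 * width S, ∀ i ≤ l, Halts C out l dg (C.δ m s h mo) (n + i)
      (cfg C out (some (!i.bodd, .back h mo)) (strTape (memBits m)) (strTape (enc C out s))
        (unaryTape dg) (unaryTape l) blankTape (oscPos !i.bodd) (oscPos !i.bodd) (i - 1)) := by
  obtain ⟨n, hn, H⟩ := halts_read (C := C) (out := out) l dg h mo m s
  have H := H (width S) 0 (by omega)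
  refine ⟨n + width S + 1, by omega, fun i => ?_⟩
  induction i with
  | zero =>
    intro _
    refine H.cons (bounded_cfg (fun _ => enc_eq_false C out s) (oscPos_bounds (S := S) _).1
      (oscPos_bounds (S := S) _).2) (tmStep_cfg_eq (p := true) _ _ none .left .right ?_
      (Function.update_eq_self _ _) (Function.update_eq_self _ _) (blankTape_update _) rfl rfl)
    have hc : candidate C s 0 = C.sto₀ := by simp [candidate]
    simp [trans, hc, unaryTape_neg_one, osc]
  | succ i ih =>
    intro hi
    refine (ih (by omega)).cons (bounded_cfg (fun _ => enc_eq_false C out s) (oscPos_bounds (S := S) _).1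
      (oscPos_bounds (S := S) _).2) ?_
    rw [Nat.bodd_succ, Bool.not_not]
    refine tmStep_cfg_eq _ _ none (osc _) .left ?_
      (Function.update_eq_self _ _) (Function.update_eq_self _ _) (blankTape_update _)
      (moveHead_osc _)
      (show moveHead .left (((i + 1 : ℕ) : ℤ) - 1) = (i : ℤ) - 1 by simp [moveHead])
    simp [trans, unaryTape_lt (show i < l by omega)]

/-- The scan stops on cell `l`, the first blank of the entry-port tape. At the same position the
degree tape shows a one exactly if `l < dg`, so the two numbers are compared without a counter. -/
lemma halts_scan (l dg : ℕ) (m : Bool) (s : S) :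
    ∃ n ≤ 3 * l + 6 + 2 * width S,
      Halts C out l dg (C.δ m s (decide (0 < l)) (decide (l < dg))) n
        (cfg C out (some (false, .scan false)) (strTape (memBits m)) (strTape (enc C out s))
        (unaryTape dg) (unaryTape l) blankTape 0 0 0) := by
  obtain ⟨n, hn, H⟩ := halts_back (C := C) (out := out) l dg (decide (0 < l)) (decide (l < dg)) m s
  have H := H l le_rfl
  suffices h : ∀ j i : ℕ, i + j = l →
      Halts C out l dg (C.δ m s (decide (0 < l)) (decide (l < dg))) (n + l + 1 + j)
        (cfg C out (some (i.bodd, .scan (decide (0 < i)))) (strTape (memBits m))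
          (strTape (enc C out s)) (unaryTape dg) (unaryTape l) blankTape (oscPos i.bodd)
          (oscPos i.bodd) i) from ⟨_, by omega, h l 0 (by omega)⟩
  intro j
  induction j with
  | zero =>
    intro i hi
    obtain rfl : i = l := by omega
    refine H.cons (bounded_cfg (fun _ => enc_eq_false C out s) (oscPos_bounds (S := S) _).1
      (oscPos_bounds (S := S) _).2) (tmStep_cfg_eq _ _ none (osc _) .left ?_
      (Function.update_eq_self _ _) (Function.update_eq_self _ _) (blankTape_update _)
      (moveHead_osc _) (by simp [moveHead]))
    have : (unaryTape dg (i : ℤ) = some true) ↔ i < dg := by simp [unaryTape]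
    simp [trans, unaryTape_self, this]
  | succ j ih =>
    intro i hi
    have ih := ih (i + 1) (by omega)
    rw [Nat.bodd_succ] at ih
    refine ih.cons (bounded_cfg (fun _ => enc_eq_false C out s) (oscPos_bounds (S := S) _).1
      (oscPos_bounds (S := S) _).2) (tmStep_cfg_eq _ _ none (osc _) .right ?_
      (Function.update_eq_self _ _) (Function.update_eq_self _ _) (blankTape_update _)
      (moveHead_osc _) (by simp [moveHead]))
    simp [trans, unaryTape_lt (show i < l by omega)]

/-! ### From local computations to executions -/

variable (C out) in
/-- The agent configuration that corresponds to a configuration of the controlled agent. -/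
noncomputable def embed {G : PortGraph} (c : Config G Bool S) : AgentConfig G :=
  ⟨c.loc, c.inPort, strTape (memBits c.mem), fun v => strTape (enc C out (c.sto v))⟩

lemma exists_localRun {G : PortGraph} (c : Config G Bool S) :
    ∃ n ≤ 3 * portLen c.inPort + 6 + 2 * width S, ∃ r,
      IsResult C out (portLen c.inPort) (G.graph.degree c.loc) (C.act c) r ∧
      (toAlgorithm C out).localRun (embed C out c) n = r ∧
      ∀ t, Bounded ((toAlgorithm C out).localRun (embed C out c) t) := by
  obtain ⟨n, hn, r, hr, hrun, hb⟩ := halts_scan (C := C) (out := out) (portLen c.inPort)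
    (G.graph.degree c.loc) c.mem (c.sto c.loc)
  have hin : decide (0 < portLen c.inPort) = c.inPort.isSome := by
    cases c.inPort <;> simp [portLen]
  rw [hin] at hr
  have hinit : (toAlgorithm C out).localInit (embed C out c) = cfg C out
      (some (false, .scan false)) (strTape (memBits c.mem)) (strTape (enc C out (c.sto c.loc)))
      (unaryTape (G.graph.degree c.loc)) (unaryTape (portLen c.inPort)) blankTape 0 0 0 := by
    unfold Algorithm.localInit cfg embed
    simp only [portTape_eq]
    congr 1
    funext j
    fin_cases j <;> rfl
  rw [← hinit] at hrun hb
  refine ⟨n, hn, r, hr, hrun, fun t => ?_⟩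
  rcases le_total t n with h | h
  · exact hb t h
  · obtain ⟨k, rfl⟩ := Nat.exists_eq_add_of_le' h
    -- The space bounds are needed at all times; after termination the configuration is constant.
    have hfix : (toAlgorithm C out).tmStep r = r := by
      obtain ⟨p, x, rfl⟩ := hr
      exact if_pos rfl
    have : (toAlgorithm C out).localRun (embed C out c) (k + n) = r := by
      rw [Algorithm.localRun, Function.iterate_add_apply, hrun, Function.iterate_fixed hfix]
    rw [this]
    exact hrun ▸ hb n le_rfl

lemma tmStep_iterate_unique {A : Algorithm} {c : TMConfig A} {t t' : ℕ}
    (h : (A.tmStep^[t] c).state = A.q₁) (h' : (A.tmStep^[t'] c).state = A.q₁) :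
    A.tmStep^[t] c = A.tmStep^[t'] c := by
  wlog hle : t ≤ t' generalizing t t'
  · exact (this h' h (by omega)).symm
  obtain ⟨k, rfl⟩ := Nat.exists_eq_add_of_le' hle
  rw [Function.iterate_add_apply]
  exact (Function.iterate_fixed (f := A.tmStep) (if_pos h) k).symm

lemma localResult_unique {A : Algorithm} {G : PortGraph} {c : AgentConfig G} {r r' : TMConfig A}
    (h : A.LocalResult c r) (h' : A.LocalResult c r') : r = r' := by
  obtain ⟨t, rfl, hs⟩ := h
  obtain ⟨t', rfl, hs'⟩ := h'
  exact tmStep_iterate_unique hs hs'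

lemma exists_localResult {G : PortGraph} (c : Config G Bool S) :
    ∃ r, IsResult C out (portLen c.inPort) (G.graph.degree c.loc) (C.act c) r ∧
      (toAlgorithm C out).LocalResult (embed C out c) r := by
  obtain ⟨n, -, r, hr, hrun, -⟩ := exists_localRun (C := C) (out := out) c
  refine ⟨r, hr, n, hrun, ?_⟩
  obtain ⟨p, x, rfl⟩ := hr
  rfl

/-- The halting configuration is unique, and its output tape determines the exit port because unary
encodings are injective. -/
lemma move_embed {G : PortGraph} (c : Config G Bool S) (x : AgentConfig G) :
    (toAlgorithm C out).Move (embed C out c) x ↔ ∃ c', C.Move c c' ∧ x = embed C out c' := by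
  obtain ⟨r, hr, hres⟩ := exists_localResult (C := C) (out := out) c
  obtain ⟨q, y, rfl⟩ := hr
  have hsto : ∀ v : G.V → S, ∀ a b, Function.update (fun v' => strTape (enc C out (v v'))) a
      (strTape (enc C out b)) = fun v' => strTape (enc C out (Function.update v a b v')) := by
    intro v a b
    funext w
    by_cases h : w = a
    · subst h; simp
    · simp [h]
  constructor
  · rintro ⟨r', hr', p, hp, rfl⟩
    obtain rfl := localResult_unique hres hr'
    refine ⟨_, ⟨p, unaryTape_injective hp, rfl⟩, ?_⟩
    simp only [embed, ← hsto]
    rfl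
  · rintro ⟨c', ⟨p, hp, rfl⟩, rfl⟩
    refine ⟨_, hres, p, congrArg unaryTape hp, ?_⟩
    simp only [embed, ← hsto]
    rfl

lemma embed_start (G : PortGraph) (v : G.V) (hm : C.mem₀ = false) (ho : out C.sto₀ = false) :
    embed C out (C.start G v) = AgentConfig.start G v := by
  have h₁ : memBits false = fun _ => false := by
    funext i; simp [memBits]
  have h₂ : enc C out C.sto₀ = fun _ => false := by
    funext i; simp [enc, ho]
  simp only [embed, start, hm, h₁, h₂]
  rfl

lemma reachesIn_iff {G : PortGraph} {v : G.V} (hm : C.mem₀ = false) (ho : out C.sto₀ = false)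
    (k : ℕ) (x : AgentConfig G) :
    (toAlgorithm C out).ReachesIn G v k x ↔
      ∃ c, C.Steps k (C.start G v) c ∧ x = embed C out c := by
  induction k generalizing x with
  | zero => simp [Algorithm.ReachesIn, Steps, embed_start G v hm ho]
  | succ k ih =>
    constructor
    · rintro ⟨y, hy, hmv⟩
      obtain ⟨c, hc, rfl⟩ := (ih y).1 hy
      obtain ⟨c', hc', rfl⟩ := (move_embed c x).1 hmv
      exact ⟨c', ⟨c, hc, hc'⟩, rfl⟩
    · rintro ⟨c', ⟨c, hc, hc'⟩, rfl⟩
      exact ⟨_, (ih _).2 ⟨c, hc, rfl⟩, (move_embed c _).2 ⟨c', hc', rfl⟩⟩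

lemma Steps.portLen_le {M T : Type} {C : Controller M T} {G : PortGraph} {v : G.V} {k : ℕ}
    {c : Config G M T} (h : C.Steps k (C.start G v) c) :
    portLen c.inPort ≤ G.graph.degree c.loc := by
  cases k with
  | zero => cases h; exact Nat.zero_le _
  | succ k =>
    obtain ⟨d, -, p, -, rfl⟩ := h
    exact (G.entry d.loc p).2

/-- A task that is solved by a controller with one bit of memory and finite storages within
polynomially many steps. -/
theorem mem_PAGT (C : Controller Bool S) (out : S → Bool) (hm : C.mem₀ = false)
    (ho : out C.sto₀ = false) (T : DecisionTask) (P : Polynomial ℕ)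
    (h : ∀ (G : PortGraph) (v : G.V), ∃ k ≤ P.eval G.order, ∃ c,
      C.Steps k (C.start G v) c ∧ C.exitLen c = 0 ∧ (G ∈ T ↔ out (C.act c).2.1 = true)) :
    T ∈ PAGT (fun _ => 1) (fun _ => width S) := by
  have hends : ∀ {G : PortGraph} (c : Config G Bool S), C.exitLen c = 0 →
      ∃ r, (toAlgorithm C out).Stop (embed C out c) r ∧
        r.tape stoTape 0 = some (out (C.act c).2.1) := by
    intro G c hc
    obtain ⟨r, ⟨q, y, rfl⟩, hres⟩ := exists_localResult (C := C) (out := out) c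
    refine ⟨_, ⟨hres, ?_⟩, ?_⟩
    · rw [blankTape_eq]
      exact congrArg unaryTape hc
    · simp [cfg, strTape, enc]
  -- The local time is at most `3 * l + 6 + 2 * width S`, where the code of the entry port has
  -- length `l ≤ degree < n`.
  refine ⟨toAlgorithm C out, ?_, ⟨P + (3 * Polynomial.X + Polynomial.C (6 + 2 * width S)), ?_⟩,
    ?_, ?_⟩
  · intro G v
    obtain ⟨k, -, c, hc, hexit, hT⟩ := h G v
    obtain ⟨r, hr, hout⟩ := hends c hexit
    refine ⟨k, _, r, (reachesIn_iff hm ho k _).2 ⟨c, hc, rfl⟩, hr, fun hG => ?_, fun hG => ?_⟩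
    · rw [hout, hT.1 hG]
    · rw [hout, Bool.eq_false_iff.2 fun h => hG (hT.2 h)]
  · intro G v
    simp only [Polynomial.eval_add, Polynomial.eval_mul, Polynomial.eval_ofNat,
      Polynomial.eval_X, Polynomial.eval_C]
    constructor
    · obtain ⟨k, hk, c, hc, hexit, -⟩ := h G v
      obtain ⟨r, hr, -⟩ := hends c hexit
      exact ⟨k, by omega, _, r, (reachesIn_iff hm ho k _).2 ⟨c, hc, rfl⟩, hr⟩
    · intro k x hx
      obtain ⟨c, hc, rfl⟩ := (reachesIn_iff hm ho k x).1 hx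
      obtain ⟨n, hn, r, ⟨q, y, rfl⟩, hrun, -⟩ := exists_localRun (C := C) (out := out) c
      have h₁ := hc.portLen_le
      have h₂ : G.graph.degree c.loc < G.order := G.graph.degree_lt_card_verts _
      exact ⟨n, by omega, by rw [hrun]; rfl⟩
  · intro n G _ v k x hx t
    obtain ⟨c, hc, rfl⟩ := (reachesIn_iff hm ho k x).1 hx
    obtain ⟨-, -, -, -, -, hb⟩ := exists_localRun (C := C) (out := out) c
    exact (hb t).1
  · intro n G _ v k x hx t
    obtain ⟨c, hc, rfl⟩ := (reachesIn_iff hm ho k x).1 hx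
    obtain ⟨-, -, -, -, -, hb⟩ := exists_localRun (C := C) (out := out) c
    exact (hb t).2

end Compile
end Controller

/-! ### Moves between adjacent nodes -/

/-- The port of `v` that leads to its neighbour `u`. -/
def PortGraph.num (G : PortGraph) (v u : G.V) : ℕ :=
  if h : G.graph.Adj v u then (G.port v ⟨u, h⟩ : ℕ) else 0

lemma PortGraph.num_eq (G : PortGraph) {v u : G.V} (h : G.graph.Adj v u) :
    G.num v u = G.port v ⟨u, h⟩ := dif_pos h

lemma PortGraph.num_lt (G : PortGraph) {v u : G.V} (h : G.graph.Adj v u) :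
    G.num v u < G.graph.degree v := by
  rw [G.num_eq h]
  exact (G.port v ⟨u, h⟩).2

lemma PortGraph.dest_port (G : PortGraph) {v u : G.V} (h : G.graph.Adj v u) :
    G.dest v (G.port v ⟨u, h⟩) = u := by
  simp [PortGraph.dest]

lemma PortGraph.adj_dest (G : PortGraph) (v : G.V) (p : Fin (G.graph.degree v)) :
    G.graph.Adj v (G.dest v p) := ((G.port v).symm p).2

lemma PortGraph.num_dest (G : PortGraph) (v : G.V) (p : Fin (G.graph.degree v)) :
    G.num v (G.dest v p) = p := by
  rw [G.num_eq (G.adj_dest v p)]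
  simp [PortGraph.dest]

lemma PortGraph.entry_eq (G : PortGraph) (v : G.V) (p : Fin (G.graph.degree v)) :
    (G.entry v p : ℕ) = G.num (G.dest v p) v :=
  (G.num_eq (G.adj_dest v p).symm).symm

namespace Controller

variable {M S : Type} {G : PortGraph}

/-- The configuration after a move from `u` to `v`. -/
def sent (u v : G.V) (m : M) (σ : G.V → S) : Config G M S := ⟨v, some (G.num v u), m, σ⟩

lemma move_iff {C : Controller M S} {c c' : Config G M S} :
    C.Move c c' ↔ ∃ w, G.graph.Adj c.loc w ∧ C.exitLen c = G.num c.loc w + 1 ∧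
      c' = sent c.loc w (C.act c).1 (Function.update c.sto c.loc (C.act c).2.1) := by
  constructor
  · rintro ⟨p, hp, rfl⟩
    refine ⟨G.dest c.loc p, G.adj_dest _ _, by rw [hp, G.num_dest], ?_⟩
    rw [sent, G.entry_eq]
  · rintro ⟨w, hw, hp, rfl⟩
    refine ⟨G.port c.loc ⟨w, hw⟩, by rw [hp, G.num_eq hw], ?_⟩
    rw [sent, G.entry_eq, G.dest_port]

lemma move_sent {C : Controller M S} {u v w : G.V} {m m' : M} {s' : S} {σ : G.V → S}
    {cp ex : Bool} (hw : G.graph.Adj v w)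
    (h : C.δ m (σ v) true (decide (G.num v u + 1 < G.graph.degree v)) = (m', s', cp, ex))
    (hp : outLen cp ex (G.num v u + 1) = G.num v w + 1) :
    C.Move (sent u v m σ) (sent v w m' (Function.update σ v s')) := by
  have ha : C.act (sent u v m σ) = (m', s', cp, ex) := h
  refine move_iff.2 ⟨w, hw, ?_, ?_⟩
  · rw [exitLen, ha]
    exact hp
  · rw [ha]
    rfl

lemma move_bounce {C : Controller M S} {u v : G.V} {m m' : M} {s' : S} {σ : G.V → S}
    (hw : G.graph.Adj u v) (h : ∀ more, C.δ m (σ v) true more = (m', s', true, false)) :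
    C.Move (sent u v m σ) (sent v u m' (Function.update σ v s')) :=
  move_sent hw.symm (h _) rfl

/-! ### Reduction of a finite memory to one bit

A message is transmitted over an edge in unary: the agent goes back and forth between the sender,
which stores what remains to be transmitted, and the receiver, which counts. -/

section OneBit

variable {N : ℕ}

/-- The next bit of the transmission of `i` by a node with storage value `s`, and the new storage
of that node. -/
def sendBit (s : S) (i : Fin (N + 1)) : Bool × S × Bool × Fin (N + 1) :=
  if (i : ℕ) = 0 then (true, s, false, 0)
  else (false, s, true, ⟨i - 1, by omega⟩)

lemma sendBit_fst (s : S) (i : Fin (N + 1)) : (sendBit s i).2.1 = s := by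
  unfold sendBit; split_ifs <;> rfl

/-- A controller with one bit of memory that simulates a controller with finite memory. A node
stores, besides the storage value, whether it is sending, and the counter of the transmission. -/
def oneBit (C : Controller M S) (e : M ≃ Fin (N + 1)) : Controller Bool (S × Bool × Fin (N + 1))
    where
  mem₀ := false
  sto₀ := (C.sto₀, false, 0)
  δ b q hasIn more :=
    -- A sending node is re-entered by the bounce from the receiver and emits the next bit of its
    -- message.
    if q.2.1 = true then ((sendBit q.1 q.2.2).1, (sendBit q.1 q.2.2).2, true, false)
    -- The bit `true` ends a message, so the counter is now the code of the memory; without an entry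
    -- port the simulation is just beginning.
    else if b = true ∨ hasIn = false then
      let r := C.δ (if hasIn then e.symm q.2.2 else C.mem₀) q.1 hasIn more
      ((sendBit r.2.1 (e r.1)).1, (sendBit r.2.1 (e r.1)).2, r.2.2)
    -- The bit `false` is one more unit of the message. The minimum only keeps the counter in range;
    -- correct transmissions never exceed `N`.
    else (false, (q.1, false, ⟨min (q.2.2 + 1) N, by omega⟩), true, false)

/-- The storages when no transmission is under way. -/
def idle (N : ℕ) (σ : G.V → S) : G.V → S × Bool × Fin (N + 1) := fun x => (σ x, false, 0)

/-- The configuration of the simulating controller after `j` rounds of the transmission of the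
memory contents `i` from `u` to `v`. -/
def transmission (u v : G.V) (i : Fin (N + 1)) (σ : G.V → S)
    (j : Fin (N + 1)) : Config G Bool (S × Bool × Fin (N + 1)) :=
  sent u v (sendBit (σ u) (⟨i - j, by omega⟩ : Fin (N + 1))).1
    (Function.update (Function.update (idle N σ) v (σ v, false, j)) u
      (sendBit (σ u) (⟨i - j, by omega⟩ : Fin (N + 1))).2)

lemma steps_transmission_succ (C : Controller M S) (e : M ≃ Fin (N + 1)) {u v : G.V}
    (h : G.graph.Adj u v) (i : Fin (N + 1)) (σ : G.V → S) {j : ℕ} (hj : j < i) :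
    (C.oneBit e).Steps 2 (transmission u v i σ ⟨j, by omega⟩)
      (transmission u v i σ ⟨j + 1, by omega⟩) := by
  have hne : v ≠ u := h.ne'
  have hij : (i : ℕ) - j ≠ 0 := by omega
  have hfirst : transmission u v i σ ⟨j, by omega⟩ = sent u v false
      (Function.update (Function.update (idle N σ) v (σ v, false, ⟨j, by omega⟩)) u
        (σ u, true, ⟨i - j - 1, by omega⟩)) := by
    simp [transmission, sendBit, hij]
  rw [hfirst]
  refine Steps.trans (k := 1) (l := 1) (Move.steps (move_bounce h
    (s' := (σ v, false, ⟨j + 1, by omega⟩)) (m' := false) ?_)) ?_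
  · intro more
    rw [Function.update_of_ne hne, Function.update_self]
    have : min (j + 1) N = j + 1 := by omega
    simp [oneBit, this]
  · have hm : (C.oneBit e).Move (sent v u false
        (Function.update (Function.update (Function.update (idle N σ) v (σ v, false, ⟨j, by omega⟩))
          u (σ u, true, ⟨i - j - 1, by omega⟩)) v (σ v, false, ⟨j + 1, by omega⟩))) _ :=
      move_bounce h.symm
        (s' := (sendBit (σ u) (⟨i - (j + 1), by omega⟩ : Fin (N + 1))).2)
        (m' := (sendBit (σ u) (⟨i - (j + 1), by omega⟩ : Fin (N + 1))).1) ?_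
    · convert hm.steps using 1
      unfold transmission
      congr 1
      funext x
      by_cases hu : x = u
      · subst hu; simp
      · by_cases hv : x = v
        · subst hv; simp [hu]
        · simp [hu, hv]
    · intro more
      rw [Function.update_of_ne hne.symm, Function.update_self]
      simp [oneBit, Nat.sub_sub]

lemma steps_transmission (C : Controller M S) (e : M ≃ Fin (N + 1)) {u v : G.V}
    (h : G.graph.Adj u v) (i : Fin (N + 1)) (σ : G.V → S) :
    ∀ j (hj : j ≤ (i : ℕ)), (C.oneBit e).Steps (2 * j) (transmission u v i σ 0)
      (transmission u v i σ ⟨j, by omega⟩) := by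
  intro j
  induction j with
  | zero => intro _; rfl
  | succ j ih => exact fun hj => (ih (by omega)).trans (steps_transmission_succ C e h i σ hj)

/-- The configuration `d` of the simulating controller corresponds to `c`. -/
def Simulates (C : Controller M S) (e : M ≃ Fin (N + 1)) (c : Config G M S)
    (d : Config G Bool (S × Bool × Fin (N + 1))) : Prop :=
  (c.inPort = none ∧ c.mem = C.mem₀ ∧ d = ⟨c.loc, none, false, idle N c.sto⟩) ∨
    ∃ u, G.graph.Adj u c.loc ∧ c.inPort = some (G.num c.loc u) ∧
      d = transmission u c.loc (e c.mem) c.sto 0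

/-- All round trips use one edge, so at the end of the message the receiver sees the same entry port
as the simulated agent and can apply `C.δ`. A message costs at most `N` round trips. -/
lemma Simulates.exists_steps {C : Controller M S} {e : M ≃ Fin (N + 1)} {c : Config G M S}
    {d : Config G Bool (S × Bool × Fin (N + 1))} (h : Simulates C e c d) :
    ∃ n ≤ 2 * N, ∃ b τ, (C.oneBit e).Steps n d ⟨c.loc, c.inPort, b, τ⟩ ∧
      (C.oneBit e).act ⟨c.loc, c.inPort, b, τ⟩ =
        ((sendBit (C.act c).2.1 (e (C.act c).1)).1, (sendBit (C.act c).2.1 (e (C.act c).1)).2,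
          (C.act c).2.2) ∧
      ∀ x, x ≠ c.loc → τ x = idle N c.sto x := by
  rcases h with ⟨hin, hmem, rfl⟩ | ⟨u, hu, hin, rfl⟩
  · refine ⟨0, by omega, false, idle N c.sto, ?_, ?_, fun _ _ => rfl⟩
    · rw [hin]; rfl
    · simp [act, oneBit, hin, hmem, idle]
  · have h := steps_transmission C e hu (e c.mem) c.sto (e c.mem) le_rfl
    refine ⟨2 * (e c.mem : ℕ), by omega, _, _, by rw [hin]; exact h, ?_, ?_⟩
    · simp [act, oneBit, hin, sendBit, hu.ne', Function.update_of_ne]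
    · intro x hx
      by_cases hxu : x = u
      · subst hxu; simp [sendBit, idle]
      · simp [hxu, hx]

lemma Simulates.move {C : Controller M S} {e : M ≃ Fin (N + 1)} {c c' : Config G M S}
    {d : Config G Bool (S × Bool × Fin (N + 1))} (h : Simulates C e c d) (hm : C.Move c c') :
    ∃ n ≤ 2 * N + 1, ∃ d', (C.oneBit e).Steps n d d' ∧ Simulates C e c' d' := by
  obtain ⟨n, hn, b, τ, hs, ha, hτ⟩ := h.exists_steps
  obtain ⟨w, hw, hl, rfl⟩ := move_iff.1 hm
  refine ⟨n + 1, by omega, _, hs.trans (Move.steps (move_iff.2 ⟨w, hw, ?_, rfl⟩)),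
    Or.inr ⟨c.loc, hw, rfl, ?_⟩⟩
  · rw [← hl, exitLen, exitLen, ha]
  · rw [ha]
    simp only [transmission, sent, Fin.coe_ofNat_eq_mod, Nat.zero_mod, Nat.sub_zero, Fin.eta,
      Function.update_self]
    congr 1
    funext x
    by_cases hx : x = c.loc
    · subst hx; simp
    · by_cases hxw : x = w
      · subst hxw; simp [hx, hτ x hx, idle]
      · simp [hx, hxw, hτ x hx, idle]

lemma exists_simulates (C : Controller M S) (e : M ≃ Fin (N + 1)) {v : G.V} {k : ℕ}
    {c : Config G M S} (h : C.Steps k (C.start G v) c) :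
    ∃ n ≤ (2 * N + 1) * k, ∃ d, (C.oneBit e).Steps n ((C.oneBit e).start G v) d ∧
      Simulates C e c d := by
  induction k generalizing c with
  | zero => cases h; exact ⟨0, by omega, _, rfl, Or.inl ⟨rfl, rfl, rfl⟩⟩
  | succ k ih =>
    obtain ⟨c₁, h₁, hm⟩ := h
    obtain ⟨n, hn, d, hd, hsim⟩ := ih h₁
    obtain ⟨n', hn', d', hd', hsim'⟩ := hsim.move hm
    exact ⟨n + n', by rw [Nat.mul_succ]; omega, d', hd.trans hd', hsim'⟩

end OneBit

/-- A task that is solved by a controller with finite memory and finite storages within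
polynomially many steps. -/
theorem mem_PAGTTheta [Fintype M] [Fintype S] (C : Controller M S) (out : S → Bool)
    (ho : out C.sto₀ = false) (T : DecisionTask) (P : Polynomial ℕ)
    (h : ∀ (G : PortGraph) (v : G.V), ∃ k ≤ P.eval G.order, ∃ c,
      C.Steps k (C.start G v) c ∧ C.exitLen c = 0 ∧ (G ∈ T ↔ out (C.act c).2.1 = true)) :
    T ∈ PAGTTheta (fun _ => 1) (fun _ => 1) := by
  obtain ⟨N, hN⟩ : ∃ N, Fintype.card M = N + 1 :=
    ⟨Fintype.card M - 1, by have := Fintype.card_pos_iff.2 ⟨C.mem₀⟩; omega⟩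
  let e : M ≃ Fin (N + 1) := Fintype.equivFinOfCardEq hN
  refine Set.mem_biUnion (x := fun _ : ℕ => width (S × Bool × Fin (N + 1))) ?_
    (mem_PAGT (C.oneBit e) (fun q => out q.1) rfl ho T
      (Polynomial.C (2 * N + 1) * P + Polynomial.C (2 * N)) ?_)
  · refine Asymptotics.isTheta_const_const ?_ ?_
    · exact Nat.cast_ne_zero.2 (Nat.succ_ne_zero _)
    · norm_num
  · intro G v
    obtain ⟨k, hk, c, hc, hexit, hT⟩ := h G v
    obtain ⟨n, hn, d, hd, hsim⟩ := exists_simulates C e hc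
    obtain ⟨n', hn', b, τ, hd', ha, -⟩ := hsim.exists_steps
    refine ⟨n + n', ?_, _, hd.trans hd', ?_, ?_⟩
    · simp only [Polynomial.eval_add, Polynomial.eval_mul, Polynomial.eval_C]
      have := Nat.mul_le_mul_left (2 * N + 1) hk
      omega
    · rw [← hexit, exitLen, exitLen, ha]
    · rw [ha, hT, sendBit_fst]

end Controller

/-! ### Cyclic order of the neighbours -/

namespace PortGraph

variable {G : PortGraph}

/-- The neighbour of `v` that follows the neighbour `u` in the cyclic order of the ports. -/
def nxt (G : PortGraph) (v u : G.V) : G.V :=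
  if h : 0 < G.graph.degree v then G.dest v ⟨(G.num v u + 1) % G.graph.degree v, Nat.mod_lt _ h⟩
  else v

lemma degree_pos {v u : G.V} (h : G.graph.Adj v u) : 0 < G.graph.degree v :=
  (Nat.zero_le _).trans_lt (G.num_lt h)

lemma adj_nxt {v u : G.V} (h : G.graph.Adj v u) : G.graph.Adj v (G.nxt v u) := by
  rw [nxt, dif_pos (degree_pos h)]
  exact G.adj_dest _ _

lemma num_nxt {v u : G.V} (h : G.graph.Adj v u) :
    G.num v (G.nxt v u) = (G.num v u + 1) % G.graph.degree v := by
  rw [nxt, dif_pos (degree_pos h), num_dest]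

lemma num_injective {v u w : G.V} (hu : G.graph.Adj v u) (hw : G.graph.Adj v w)
    (h : G.num v u = G.num v w) : u = w := by
  rw [G.num_eq hu, G.num_eq hw, Fin.val_inj, (G.port v).injective.eq_iff] at h
  exact congrArg Subtype.val h

lemma adj_nxt_iterate {v u : G.V} (h : G.graph.Adj v u) (i : ℕ) :
    G.graph.Adj v ((G.nxt v)^[i] u) := by
  induction i with
  | zero => exact h
  | succ i ih =>
    rw [Function.iterate_succ_apply']
    exact adj_nxt ih

lemma num_nxt_iterate {v u : G.V} (h : G.graph.Adj v u) (i : ℕ) :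
    G.num v ((G.nxt v)^[i] u) = (G.num v u + i) % G.graph.degree v := by
  induction i with
  | zero => exact (Nat.mod_eq_of_lt (G.num_lt h)).symm
  | succ i ih =>
    rw [Function.iterate_succ_apply', num_nxt (adj_nxt_iterate h i), ih, Nat.mod_add_mod,
      add_assoc]

lemma nxt_iterate_degree {v u : G.V} (h : G.graph.Adj v u) :
    (G.nxt v)^[G.graph.degree v] u = u := by
  refine num_injective (adj_nxt_iterate h _) h ?_
  rw [num_nxt_iterate h, Nat.add_mod_right, Nat.mod_eq_of_lt (G.num_lt h)]

lemma nxt_iterate_ne {v u : G.V} (h : G.graph.Adj v u) {i : ℕ} (h₀ : 0 < i)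
    (hi : i < G.graph.degree v) : (G.nxt v)^[i] u ≠ u := by
  intro heq
  have h₁ := num_nxt_iterate h i
  have h₂ := G.num_lt h
  rw [heq] at h₁
  rcases lt_or_ge (G.num v u + i) (G.graph.degree v) with h₃ | h₃
  · rw [Nat.mod_eq_of_lt h₃] at h₁
    omega
  · rw [Nat.mod_eq_sub_mod h₃, Nat.mod_eq_of_lt (by omega)] at h₁
    omega

lemma exists_nxt_iterate {v u w : G.V} (hu : G.graph.Adj v u) (hw : G.graph.Adj v w) :
    ∃ i < G.graph.degree v, (G.nxt v)^[i] u = w := by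
  have h₁ := G.num_lt hu
  have h₂ := G.num_lt hw
  rcases le_or_gt (G.num v u) (G.num v w) with h | h
  · refine ⟨G.num v w - G.num v u, by omega, num_injective (adj_nxt_iterate hu _) hw ?_⟩
    rw [num_nxt_iterate hu, Nat.add_sub_cancel' h, Nat.mod_eq_of_lt h₂]
  · refine ⟨G.num v w + G.graph.degree v - G.num v u, by omega,
      num_injective (adj_nxt_iterate hu _) hw ?_⟩
    rw [num_nxt_iterate hu, Nat.add_sub_cancel' (by omega), Nat.add_mod_right,
      Nat.mod_eq_of_lt h₂]

lemma exists_nxt_iterate_succ {v u w : G.V} (hu : G.graph.Adj v u) (hw : G.graph.Adj v w)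
    (hne : w ≠ u) : ∃ i, i + 1 < G.graph.degree v ∧ (G.nxt v)^[i + 1] u = w := by
  obtain ⟨i, hi, h⟩ := exists_nxt_iterate hu hw
  cases i with
  | zero => exact absurd h.symm hne
  | succ i => exact ⟨i, hi, h⟩

end PortGraph

/-! ### A depth-first search along induced paths -/

/-- The marks of the nodes: not yet visited, finished, on the current path, the last node of the
current path, and the final result. The nodes of the current path know whether they are the root. -/
inductive Mark
  | new
  | finished
  | active (root : Bool)
  | top (root : Bool)
  | result (b : Bool)
  deriving DecidableEq, Fintype

/-- The messages that the agent carries, apart from the parity of the number of visited nodes. -/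
inductive Msg
  | explore
  | reply
  | isParent
  | pop
  | query (reject : Bool)
  | queryReply (reject : Bool)
  | accept
  | reject
  deriving DecidableEq, Fintype

/-- Exit through the cyclic successor of the entry port. -/
def nextPort (more : Bool) : Bool × Bool := (more, true)

/-- The controller that computes the parity of the number of nodes. The last node `v` of the
current path explores its neighbours in cyclic order, beginning after its predecessor. A new
neighbour becomes the last node of the path if none of its neighbours except `v` is on the path;
to find out, it queries its neighbours in cyclic order, beginning after `v`. -/
def dfs : Controller (Msg × Bool) Mark where
  mem₀ := (.reply, true)
  sto₀ := .new
  δ m s hasIn more :=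
    if hasIn = false then
      if more = true then ((.explore, true), .top true, false, true)
      -- A starting node without ports is the whole graph, of odd order `1`.
      else ((.reply, true), .result true, false, false)
    else match s, m.1 with
    | .new, .explore => ((.query false, m.2), .new, nextPort more)
    | .new, .queryReply r => ((.query r, m.2), .new, nextPort more)
    | .new, .query r => ((.queryReply r, m.2), .new, true, false)
    -- The node becomes visited, so the carried parity flips.
    | .new, .accept => ((.explore, !m.2), .top false, nextPort more)
    | .new, .reject => ((.reply, m.2), .new, true, false)
    | .finished, .explore => ((.reply, m.2), .finished, true, false)
    | .finished, .query r => ((.queryReply r, m.2), .finished, true, false)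
    | .active a, .explore => ((.isParent, m.2), .active a, true, false)
    | .active a, .query _ => ((.queryReply true, m.2), .active a, true, false)
    -- The predecessor sends the agent back to the finished child; its reply lets the cyclic
    -- exploration continue after that child.
    | .active a, .pop => ((.explore, m.2), .top a, true, false)
    | .top a, .reply =>
      -- The root began with port `0`, so a reply through its last port ends the search.
      if a = true ∧ more = false then ((.reply, m.2), .result m.2, false, false)
      else ((.explore, m.2), .top a, nextPort more)
    -- The path is induced, so the active neighbour can only be the predecessor, and all other
    -- neighbours have been explored since the node was entered.
    | .top _, .isParent => ((.pop, m.2), .finished, true, false)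
    | .top a, .query false => ((.accept, m.2), .active a, true, false)
    | .top a, .query true => ((.reject, m.2), .top a, true, false)
    | _, _ => ((.reply, m.2), s, false, false)

namespace Controller

variable {M S : Type} {G : PortGraph}

lemma move_next {C : Controller M S} {u v : G.V} {m m' : M} {s' : S} {σ : G.V → S}
    (hw : G.graph.Adj u v) (more : Bool)
    (hmore : more = decide (G.num v u + 1 < G.graph.degree v))
    (h : C.δ m (σ v) true more = (m', s', nextPort more)) :
    C.Move (sent u v m σ) (sent v (G.nxt v u) m' (Function.update σ v s')) := by
  subst hmore
  refine move_sent (PortGraph.adj_nxt hw.symm) h ?_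
  rw [PortGraph.num_nxt hw.symm]
  by_cases hlt : G.num v u + 1 < G.graph.degree v
  · simp [outLen, hlt, Nat.mod_eq_of_lt hlt]
  · have : G.num v u + 1 = G.graph.degree v := by
      have := G.num_lt hw.symm
      omega
    simp [outLen, this]

end Controller

open Controller Mark Msg

namespace dfs

/-! ### Queries of a new node to its neighbours -/

variable {G : PortGraph}

/-- The bounce of the agent at a node whose mark does not change. -/
lemma bounce_self {u v : G.V} {m m' : Msg × Bool} {σ : G.V → Mark} (h : G.graph.Adj u v)
    (hδ : ∀ more, dfs.δ m (σ v) true more = (m', σ v, true, false)) :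
    dfs.Move (sent u v m σ) (sent v u m' σ) := by
  have := move_bounce h hδ
  rwa [Function.update_eq_self] at this

/-- The marks of the nodes on the current path except the last one. -/
def IsActive (s : Mark) : Prop := ∃ a, s = active a

/-- The marks of the nodes on the current path. -/
def Live (s : Mark) : Prop := IsActive s ∨ ∃ a, s = top a

lemma query_loop {v w : G.V} (h : G.graph.Adj w v) (c : Bool) {σ : G.V → Mark}
    (hw : σ w = new)
    (hσ : ∀ x, G.graph.Adj w x → x ≠ v → σ x = new ∨ σ x = finished ∨ IsActive (σ x)) (i : ℕ)
    (hi : i < G.graph.degree w) :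
    ∃ r, dfs.Steps (2 * i) (sent w (G.nxt w v) (query false, c) σ)
        (sent w ((G.nxt w)^[i + 1] v) (query r, c) σ) ∧
      (r = true ↔ ∃ j < i, IsActive (σ ((G.nxt w)^[j + 1] v))) := by
  induction i with
  | zero => exact ⟨false, rfl, by simp⟩
  | succ i ih =>
    obtain ⟨r, hr, hrej⟩ := ih (by omega)
    have hadj := PortGraph.adj_nxt_iterate h (i + 1)
    have hx := hσ _ hadj (PortGraph.nxt_iterate_ne h (by omega) hi)
    obtain ⟨r', hr', hrej'⟩ : ∃ r', (∀ more, dfs.δ (query r, c) (σ ((G.nxt w)^[i + 1] v)) true more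
        = ((queryReply r', c), σ ((G.nxt w)^[i + 1] v), true, false)) ∧
        (r' = true ↔ r = true ∨ IsActive (σ ((G.nxt w)^[i + 1] v))) := by
      rcases hx with hx | hx | ⟨a, hx⟩
      · exact ⟨r, fun _ => by rw [hx]; rfl, by rw [hx]; simp [IsActive]⟩
      · exact ⟨r, fun _ => by rw [hx]; rfl, by rw [hx]; simp [IsActive]⟩
      · exact ⟨true, fun _ => by rw [hx]; rfl, by rw [hx]; simp [IsActive]⟩
    have h₁ := bounce_self hadj hr'
    have h₂ := move_next (C := dfs) (σ := σ) (m := (queryReply r', c)) (m' := (query r', c))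
      (s' := new) hadj.symm _ rfl (by rw [hw]; rfl)
    rw [← hw, Function.update_eq_self, ← Function.iterate_succ_apply' (f := G.nxt w)] at h₂
    refine ⟨r', (hr.trans (h₁.steps.trans h₂.steps)), ?_⟩
    rw [hrej', hrej]
    constructor
    · rintro (⟨j, hj, h'⟩ | h')
      · exact ⟨j, by omega, h'⟩
      · exact ⟨i, by omega, h'⟩
    · rintro ⟨j, hj, h'⟩
      rcases Nat.lt_succ_iff_lt_or_eq.1 hj with hj | rfl
      · exact Or.inl ⟨j, hj, h'⟩
      · exact Or.inr h'

/-- After `degree w - 1` round trips the cyclic order returns to `v`, which is not active, so all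
active neighbours have been met on the way. -/
lemma query_all {v w : G.V} (h : G.graph.Adj w v) (c : Bool) {σ : G.V → Mark}
    (hw : σ w = new) (hv : ¬ IsActive (σ v))
    (hσ : ∀ x, G.graph.Adj w x → x ≠ v → σ x = new ∨ σ x = finished ∨ IsActive (σ x)) :
    ∃ r, dfs.Steps (2 * (G.graph.degree w - 1)) (sent w (G.nxt w v) (query false, c) σ)
        (sent w v (query r, c) σ) ∧ (r = true ↔ ∃ x, G.graph.Adj w x ∧ IsActive (σ x)) := by
  have hd := PortGraph.degree_pos h
  obtain ⟨r, hr, hrej⟩ := query_loop h c hw hσ (G.graph.degree w - 1) (by omega)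
  rw [Nat.sub_add_cancel hd, PortGraph.nxt_iterate_degree h] at hr
  refine ⟨r, hr, hrej.trans ⟨?_, ?_⟩⟩
  · rintro ⟨j, -, hj⟩
    exact ⟨_, PortGraph.adj_nxt_iterate h _, hj⟩
  · rintro ⟨x, hx, hact⟩
    obtain ⟨j, hj, rfl⟩ := PortGraph.exists_nxt_iterate_succ h hx (by rintro rfl; exact hv hact)
    exact ⟨j, by omega, hact⟩

/-! ### Invariants of the exploration -/

/-- The number of new nodes. -/
def numNew (σ : G.V → Mark) : ℕ := (Finset.univ.filter fun x => σ x = new).card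

/-- The parity of the number of visited nodes. -/
def parity (σ : G.V → Mark) : Bool := (G.order + numNew σ).bodd

lemma numNew_congr {σ σ' : G.V → Mark} (h : ∀ y, σ' y = new ↔ σ y = new) :
    numNew σ' = numNew σ := by
  unfold numNew
  congr 1
  ext y
  simp [h]

lemma numNew_visit {σ σ' : G.V → Mark} {x : G.V} (hx : σ x = new) (hx' : σ' x ≠ new)
    (h : ∀ y, y ≠ x → (σ' y = new ↔ σ y = new)) : numNew σ' + 1 = numNew σ := by
  unfold numNew
  rw [← Finset.card_insert_of_notMem (a := x) (by simp [hx'])]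
  congr 1
  ext y
  by_cases hy : y = x
  · subst hy; simp [hx]
  · simp [hy, h y hy]

lemma parity_visit {σ σ' : G.V → Mark} (h : numNew σ' + 1 = numNew σ) :
    parity σ' = !parity σ := by
  unfold parity
  rw [← h, ← add_assoc, Nat.bodd_succ, Bool.not_not]

/-- The effect of the exploration of a neighbour of the last node of the current path. -/
structure Explored (σ σ' : G.V → Mark) : Prop where
  old : ∀ y, σ y ≠ new → σ' y = σ y
  fresh : ∀ y, σ y = new → σ' y = new ∨ σ' y = finished
  -- The second alternative covers rejected nodes: they are still adjacent to the path from which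
  -- the exploration started.
  nbr : ∀ y z, σ y = new → σ' y = finished → G.graph.Adj y z →
    σ' z ≠ new ∨ ∃ a, G.graph.Adj z a ∧ Live (σ a)

lemma Explored.refl (σ : G.V → Mark) : Explored σ σ where
  old _ _ := rfl
  fresh _ h := Or.inl h
  nbr y z h h' := by rw [h] at h'; cases h'

lemma Explored.ne_new {σ σ' : G.V → Mark} (h : Explored σ σ') {y : G.V} (hy : σ y ≠ new) :
    σ' y ≠ new := by rwa [h.old y hy]

lemma Explored.eq_of_ne {σ σ' : G.V → Mark} (h : Explored σ σ') {y : G.V} (h₁ : σ' y ≠ new)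
    (h₂ : σ' y ≠ finished) : σ y = σ' y := by
  by_cases hy : σ y = new
  · rcases h.fresh y hy with h' | h'
    · exact absurd h' h₁
    · exact absurd h' h₂
  · exact (h.old y hy).symm

lemma Explored.isActive {σ σ' : G.V → Mark} (h : Explored σ σ') {y : G.V}
    (hy : IsActive (σ' y)) : IsActive (σ y) := by
  obtain ⟨a, ha⟩ := hy
  exact ⟨a, (h.eq_of_ne (by simp [ha]) (by simp [ha])).trans ha⟩

lemma Explored.live {σ σ' : G.V → Mark} (h : Explored σ σ') {y : G.V} (hy : Live (σ' y)) :
    Live (σ y) := by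
  rcases hy with hy | ⟨a, ha⟩
  · exact Or.inl (h.isActive hy)
  · exact Or.inr ⟨a, (h.eq_of_ne (by simp [ha]) (by simp [ha])).trans ha⟩

lemma Explored.trans {σ₀ σ₁ σ₂ : G.V → Mark} (h₁ : Explored σ₀ σ₁) (h₂ : Explored σ₁ σ₂) :
    Explored σ₀ σ₂ where
  old y hy := (h₂.old y (h₁.ne_new hy)).trans (h₁.old y hy)
  fresh y hy := by
    rcases h₁.fresh y hy with h | h
    · exact h₂.fresh y h
    · exact Or.inr ((h₂.old y (by simp [h])).trans h)
  nbr y z hy hy' hz := by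
    rcases h₁.fresh y hy with h | h
    · rcases h₂.nbr y z h hy' hz with h' | ⟨a, ha, hl⟩
      · exact Or.inl h'
      · exact Or.inr ⟨a, ha, h₁.live hl⟩
    · rcases h₁.nbr y z hy h hz with h' | h'
      · exact Or.inl (h₂.ne_new h')
      · exact Or.inr h'

lemma Explored.numNew_le {σ σ' : G.V → Mark} (h : Explored σ σ') : numNew σ' ≤ numNew σ := by
  refine Finset.card_le_card fun y hy => ?_
  simp only [Finset.mem_filter, Finset.mem_univ, true_and] at hy ⊢
  by_contra hne
  exact h.ne_new hne hy

/-- The only node with mark `top` is `v`, and there is no result yet. -/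
def OnlyTop (σ : G.V → Mark) (v : G.V) : Prop :=
  (∃ a, σ v = top a) ∧ (∀ y a, σ y = top a → y = v) ∧ ∀ y b, σ y ≠ result b

lemma OnlyTop.cases {σ : G.V → Mark} {v y : G.V} (h : OnlyTop σ v) (hy : y ≠ v) :
    σ y = new ∨ σ y = finished ∨ IsActive (σ y) := by
  cases hs : σ y with
  | new => exact Or.inl rfl
  | finished => exact Or.inr (Or.inl rfl)
  | active a => exact Or.inr (Or.inr ⟨a, rfl⟩)
  | top a => exact absurd (h.2.1 y a hs) hy
  | result b => exact absurd hs (h.2.2 y b)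

lemma Explored.onlyTop {σ σ' : G.V → Mark} {v : G.V} (h : Explored σ σ') (hv : OnlyTop σ v) :
    OnlyTop σ' v := by
  obtain ⟨⟨a, ha⟩, h₂, h₃⟩ := hv
  refine ⟨⟨a, (h.old v (by simp [ha])).trans ha⟩, fun y b hy => ?_, fun y b hy => ?_⟩
  · exact h₂ y b ((h.eq_of_ne (by simp [hy]) (by simp [hy])).trans hy)
  · exact h₃ y b ((h.eq_of_ne (by simp [hy]) (by simp [hy])).trans hy)

/-- The time for the exploration of a neighbour without a visit of new nodes. -/
def baseCost (G : PortGraph) : ℕ := 2 * G.order + 1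

/-- The additional time for each new node that is visited. -/
def nodeCost (G : PortGraph) : ℕ := G.order * (baseCost G + 1) + 2 * G.order + 5

/-- The specification of the exploration of the neighbour `x` of the last node `v` of the current
path. -/
def Explores (σ : G.V → Mark) (v x : G.V) : Prop :=
  ∃ k σ', dfs.Steps k (sent v x (explore, parity σ) σ) (sent x v (reply, parity σ') σ') ∧
    Explored σ σ' ∧ (σ' x ≠ new ∨ ∃ a, G.graph.Adj x a ∧ IsActive (σ a)) ∧
    k + nodeCost G * numNew σ' ≤ nodeCost G * numNew σ + baseCost G

/-- All neighbours can be explored when there are at most `n` new nodes. -/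
def ExploresUpTo (G : PortGraph) (n : ℕ) : Prop :=
  ∀ (σ : G.V → Mark) (v x : G.V), numNew σ ≤ n → OnlyTop σ v → G.graph.Adj v x →
    ¬ IsActive (σ x) → Explores σ v x

/-- The assumption `hroot` prevents the root from getting a reply through its last port inside the
loop, as this would end the execution. The costs telescope since `numNew` acts as a potential. -/
lemma explore_loop {n : ℕ} (ih : ExploresUpTo G n) {σ : G.V → Mark} (hn : numNew σ ≤ n)
    {v u : G.V} (h : G.graph.Adj v u) (hv : OnlyTop σ v) (i : ℕ)
    (hact : ∀ j < i, ¬ IsActive (σ ((G.nxt v)^[j + 1] u)))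
    (hroot : σ v = top false ∨
      ∀ j < i, G.num v ((G.nxt v)^[j + 1] u) + 1 < G.graph.degree v) :
    ∃ k σ', dfs.Steps k (sent v (G.nxt v u) (explore, parity σ) σ)
        (sent v ((G.nxt v)^[i + 1] u) (explore, parity σ') σ') ∧ Explored σ σ' ∧
      (∀ j < i, σ' ((G.nxt v)^[j + 1] u) ≠ new ∨
        ∃ a, G.graph.Adj ((G.nxt v)^[j + 1] u) a ∧ IsActive (σ a)) ∧
      k + nodeCost G * numNew σ' ≤ nodeCost G * numNew σ + i * (baseCost G + 1) := by
  induction i with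
  | zero => exact ⟨0, σ, rfl, Explored.refl σ, by simp, by simp⟩
  | succ i ih' =>
    obtain ⟨k, σ₁, hk, he, hnbr, hcost⟩ := ih' (fun j hj => hact j (by omega))
      (hroot.imp_right fun h j hj => h j (by omega))
    have hadj := PortGraph.adj_nxt_iterate h (i + 1)
    obtain ⟨k', σ₂, hk', he', hx, hcost'⟩ := ih σ₁ v _ (he.numNew_le.trans hn) (he.onlyTop hv)
      hadj fun h' => hact i (by omega) (he.isActive h')
    obtain ⟨⟨a, ha⟩, -, -⟩ := hv
    have ha₂ : σ₂ v = top a := ((he.trans he').old v (by simp [ha])).trans ha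
    have hmove := move_next (C := dfs) (σ := σ₂) (m := (reply, parity σ₂))
      (m' := (explore, parity σ₂)) (s' := top a) hadj.symm _ rfl (by
        rw [ha₂]
        rcases hroot with hr | hr
        · obtain rfl : a = false := by rw [ha] at hr; simpa using hr
          simp [dfs]
        · have := hr i (by omega)
          rw [decide_eq_true this]
          simp [dfs])
    rw [← ha₂, Function.update_eq_self, ← Function.iterate_succ_apply' (f := G.nxt v)] at hmove
    refine ⟨k + (k' + 1), σ₂, hk.trans (hk'.trans hmove.steps), he.trans he', fun j hj => ?_, ?_⟩
    · rcases Nat.lt_succ_iff_lt_or_eq.1 hj with hj | rfl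
      · exact (hnbr j hj).imp_left he'.ne_new
      · exact hx.imp_right fun ⟨b, hb, hb'⟩ => ⟨b, hb, he.isActive hb'⟩
    · rw [Nat.add_one_mul i]
      omega

lemma explores_finished {σ : G.V → Mark} {v x : G.V} (h : G.graph.Adj v x)
    (hx : σ x = finished) : Explores σ v x := by
  refine ⟨1, σ, (bounce_self h fun _ => ?_).steps, Explored.refl σ, Or.inl (by simp [hx]), ?_⟩
  · rw [hx]; rfl
  · unfold baseCost; omega

lemma explores_rejected {σ : G.V → Mark} {v x : G.V} (hv : OnlyTop σ v) (h : G.graph.Adj v x)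
    (hx : σ x = new) {k : ℕ} (hk : k + 2 ≤ baseCost G)
    (hr : dfs.Steps k (sent v x (explore, parity σ) σ) (sent x v (query true, parity σ) σ))
    (ha : ∃ a, G.graph.Adj x a ∧ IsActive (σ a)) : Explores σ v x := by
  obtain ⟨⟨a, hva⟩, -, -⟩ := hv
  refine ⟨k + 2, σ, hr.trans (Steps.trans (k := 1) (l := 1)
    (bounce_self h.symm (m' := (reject, parity σ)) fun _ => by rw [hva]; rfl).steps
    (bounce_self h fun _ => by rw [hx]; rfl).steps), Explored.refl σ, Or.inr ha, by omega⟩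

/-- The predecessor `v` becomes active and `x` becomes the top. The loop explores all neighbours of
`x` except `v`; its final message reaches `v`, which identifies itself as the parent, whereupon `x`
is finished and `v` is the top again. The storages `σ₁`, …, `σ₅` record these changes. -/
lemma explores_accepted {n : ℕ} (ih : ExploresUpTo G n) {σ : G.V → Mark}
    (hn : numNew σ ≤ n + 1) {v x : G.V} (hv : OnlyTop σ v) (h : G.graph.Adj v x)
    (hx : σ x = new) {k : ℕ} (hk : k + 2 ≤ baseCost G)
    (hr : dfs.Steps k (sent v x (explore, parity σ) σ) (sent x v (query false, parity σ) σ))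
    (hna : ¬ ∃ a, G.graph.Adj x a ∧ IsActive (σ a)) : Explores σ v x := by
  obtain ⟨⟨ρ, hva⟩, htop, hres⟩ := id hv
  have hne : x ≠ v := h.ne'
  have hdeg : 0 < G.graph.degree x := PortGraph.degree_pos h.symm
  obtain ⟨σ₁, hσ₁⟩ : ∃ σ₁, σ₁ = Function.update σ v (active ρ) := ⟨_, rfl⟩
  obtain ⟨σ₂, hσ₂⟩ : ∃ σ₂, σ₂ = Function.update σ₁ x (top false) := ⟨_, rfl⟩
  have h₁x : σ₁ x = new := by rw [hσ₁, Function.update_of_ne hne, hx]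
  have h₂x : σ₂ x = top false := by rw [hσ₂, Function.update_self]
  have h₂v : σ₂ v = active ρ := by
    rw [hσ₂, Function.update_of_ne hne.symm, hσ₁, Function.update_self]
  have h₂ : ∀ y, y ≠ x → y ≠ v → σ₂ y = σ y := fun y hyx hyv => by
    rw [hσ₂, Function.update_of_ne hyx, hσ₁, Function.update_of_ne hyv]
  have hnew₂ : numNew σ₂ + 1 = numNew σ := numNew_visit hx (by simp [h₂x]) fun y hy => by
    by_cases hyv : y = v
    · subst hyv; simp [h₂v, hva]
    · rw [h₂ y hy hyv]
  have hpar₂ := parity_visit hnew₂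
  have htop₂ : OnlyTop σ₂ x := by
    refine ⟨⟨false, h₂x⟩, fun y a hy => ?_, fun y b hy => ?_⟩
    · by_contra hyx
      by_cases hyv : y = v
      · subst hyv; simp [h₂v] at hy
      · exact hyv (htop y a (by rwa [h₂ y hyx hyv] at hy))
    · by_cases hyx : y = x
      · subst hyx; simp [h₂x] at hy
      · by_cases hyv : y = v
        · subst hyv; simp [h₂v] at hy
        · exact hres y b (by rwa [h₂ y hyx hyv] at hy)
  have hact₂ : ∀ y, G.graph.Adj x y → y ≠ v → ¬ IsActive (σ₂ y) := fun y hy hyv hyact =>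
    hna ⟨y, hy, by rwa [h₂ y hy.ne' hyv] at hyact⟩
  obtain ⟨l, σ₃, hl, he, hnbr, hcost⟩ := explore_loop ih (by omega) h.symm htop₂
    (G.graph.degree x - 1)
    (fun j hj => hact₂ _ (PortGraph.adj_nxt_iterate h.symm _)
      (PortGraph.nxt_iterate_ne h.symm (by omega) (by omega))) (Or.inl h₂x)
  rw [Nat.sub_add_cancel hdeg, PortGraph.nxt_iterate_degree h.symm] at hl
  have h₃x : σ₃ x = top false := (he.old x (by simp [h₂x])).trans h₂x
  have h₃v : σ₃ v = active ρ := (he.old v (by simp [h₂v])).trans h₂v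
  obtain ⟨σ₄, hσ₄⟩ : ∃ σ₄, σ₄ = Function.update σ₃ x finished := ⟨_, rfl⟩
  obtain ⟨σ₅, hσ₅⟩ : ∃ σ₅, σ₅ = Function.update σ₄ v (top ρ) := ⟨_, rfl⟩
  have h₄v : σ₄ v = active ρ := by rw [hσ₄, Function.update_of_ne hne.symm, h₃v]
  have h₅v : σ₅ v = top ρ := by rw [hσ₅, Function.update_self]
  have h₅x : σ₅ x = finished := by
    rw [hσ₅, Function.update_of_ne hne, hσ₄, Function.update_self]
  have h₅ : ∀ y, y ≠ x → y ≠ v → σ₅ y = σ₃ y := fun y hyx hyv => by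
    rw [hσ₅, Function.update_of_ne hyv, hσ₄, Function.update_of_ne hyx]
  have h₅new : ∀ y, σ₅ y = new ↔ σ₃ y = new := fun y => by
    by_cases hyx : y = x
    · subst hyx; simp [h₅x, h₃x]
    · by_cases hyv : y = v
      · subst hyv; simp [h₅v, h₃v]
      · rw [h₅ y hyx hyv]
  have hnew₅ : numNew σ₅ = numNew σ₃ := numNew_congr h₅new
  have hpar₅ : parity σ₅ = parity σ₃ := by unfold parity; rw [hnew₅]
  -- While `x` is explored, the path is the old path together with `x`, so a live neighbour other
  -- than `x` was live before.
  have hlive : ∀ z, (∃ a, G.graph.Adj z a ∧ Live (σ₂ a)) → z ≠ v → ¬ G.graph.Adj z x →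
      ∃ a, G.graph.Adj z a ∧ Live (σ a) := by
    rintro z ⟨a, haz, ha⟩ hzv hzx
    refine ⟨a, haz, ?_⟩
    by_cases hav : a = v
    · subst hav; exact Or.inr ⟨ρ, hva⟩
    · rwa [h₂ a (by rintro rfl; exact hzx haz) hav] at ha
  -- A neighbour rejected during the exploration of `x` has an active neighbour, which cannot be the
  -- top `x` and hence lies on the old path.
  have hnbrx : ∀ z, G.graph.Adj x z → σ₅ z ≠ new ∨ ∃ a, G.graph.Adj z a ∧ Live (σ a) := by
    intro z hz
    by_cases hzv : z = v
    · subst hzv; exact Or.inl (by simp [h₅v])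
    · obtain ⟨j, hj, rfl⟩ := PortGraph.exists_nxt_iterate_succ h.symm hz hzv
      refine (hnbr j (by omega)).imp (fun h' => by rwa [Ne, h₅new]) ?_
      rintro ⟨a, haz, ha⟩
      refine ⟨a, haz, ?_⟩
      by_cases hav : a = v
      · subst hav; exact Or.inr ⟨ρ, hva⟩
      · by_cases hax : a = x
        · subst hax; rw [h₂x] at ha; obtain ⟨b, hb⟩ := ha; cases hb
        · rw [h₂ a hax hav] at ha; exact Or.inl ha
  refine ⟨k + (1 + (1 + (l + (1 + (1 + (1 + 1)))))), σ₅, ?_, ⟨fun y hy => ?_, fun y hy => ?_,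
    fun y z hy hy' hz => ?_⟩, Or.inl (by simp [h₅x]), ?_⟩
  · have s₁ : dfs.Move (sent x v (query false, parity σ) σ) (sent v x (accept, parity σ) σ₁) :=
      hσ₁ ▸ move_bounce h.symm fun _ => by rw [hva]; rfl
    have s₂ : dfs.Move (sent v x (accept, parity σ) σ₁)
        (sent x (G.nxt x v) (explore, parity σ₂) σ₂) := by
      rw [hσ₂, ← hσ₂, hpar₂]
      exact hσ₂ ▸ move_next h _ rfl (by rw [h₁x]; rfl)
    have s₃ : dfs.Move (sent x v (explore, parity σ₃) σ₃) (sent v x (isParent, parity σ₃) σ₃) :=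
      bounce_self h.symm fun _ => by rw [h₃v]; rfl
    have s₄ : dfs.Move (sent v x (isParent, parity σ₃) σ₃) (sent x v (pop, parity σ₃) σ₄) :=
      hσ₄ ▸ move_bounce h fun _ => by rw [h₃x]; rfl
    have s₅ : dfs.Move (sent x v (pop, parity σ₃) σ₄) (sent v x (explore, parity σ₃) σ₅) :=
      hσ₅ ▸ move_bounce h.symm fun _ => by rw [h₄v]; rfl
    have s₆ : dfs.Move (sent v x (explore, parity σ₃) σ₅) (sent x v (reply, parity σ₅) σ₅) := by
      rw [hpar₅]
      exact bounce_self h fun _ => by rw [h₅x]; rfl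
    exact hr.trans (s₁.steps.trans (s₂.steps.trans (hl.trans (s₃.steps.trans (s₄.steps.trans
      (s₅.steps.trans s₆.steps))))))
  · have hyx : y ≠ x := by rintro rfl; exact hy hx
    by_cases hyv : y = v
    · subst hyv; rw [h₅v, hva]
    · rw [h₅ y hyx hyv, ← h₂ y hyx hyv]
      exact he.old y (by rwa [h₂ y hyx hyv])
  · by_cases hyx : y = x
    · subst hyx; exact Or.inr h₅x
    · have hyv : y ≠ v := by rintro rfl; rw [hva] at hy; cases hy
      rw [h₅ y hyx hyv]
      exact he.fresh y (by rwa [h₂ y hyx hyv])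
  · by_cases hyx : y = x
    · subst hyx; exact hnbrx z hz
    · have hyv : y ≠ v := by rintro rfl; rw [hva] at hy; cases hy
      by_cases hzx : G.graph.Adj x z
      · exact hnbrx z hzx
      · by_cases hzv : z = v
        · subst hzv; exact Or.inl (by simp [h₅v])
        · refine (he.nbr y z (by rwa [h₂ y hyx hyv]) (by rwa [h₅ y hyx hyv] at hy') hz).imp
            (fun h' => by rwa [Ne, h₅new]) fun h' => hlive z h' hzv fun h'' => hzx h''.symm
  · have hd : G.graph.degree x ≤ G.order := (G.graph.degree_lt_card_verts x).le
    have h₁ : (G.graph.degree x - 1) * (baseCost G + 1) ≤ G.order * (baseCost G + 1) :=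
      Nat.mul_le_mul_right _ (by omega)
    -- The visit of `x` releases one `nodeCost`, which pays for the loop, the `k` steps of the query
    -- and the six remaining bounces and moves.
    have h₂ : nodeCost G * numNew σ = nodeCost G * numNew σ₂ + nodeCost G := by
      rw [← hnew₂, Nat.mul_succ]
    have h₃ : nodeCost G = G.order * (baseCost G + 1) + 2 * G.order + 5 := rfl
    have h₄ : baseCost G = 2 * G.order + 1 := rfl
    rw [hnew₅]
    omega

/-- Induction on the number of new nodes: an accepted neighbour is visited before its own neighbours
are explored, so fewer new nodes remain. -/
lemma exploresUpTo (G : PortGraph) (n : ℕ) : ExploresUpTo G n := by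
  have main : ∀ (σ : G.V → Mark) (v x : G.V), OnlyTop σ v → G.graph.Adj v x →
      ¬ IsActive (σ x) → (σ x = new → ∃ m, numNew σ ≤ m + 1 ∧ ExploresUpTo G m) →
      Explores σ v x := by
    intro σ v x hv h hx ih
    rcases hv.cases h.ne' with hs | hs | hs
    · obtain ⟨m, hm, ih⟩ := ih hs
      have hnv : ¬ IsActive (σ v) := by
        obtain ⟨⟨a, ha⟩, -, -⟩ := hv
        rintro ⟨b, hb⟩
        rw [ha] at hb
        cases hb
      obtain ⟨r, hr, hiff⟩ := query_all h.symm (parity σ) hs hnv fun y _ hyv => hv.cases hyv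
      have s₁ := move_next (C := dfs) (σ := σ) (m := (explore, parity σ))
        (m' := (query false, parity σ)) (s' := new) h _ rfl (by rw [hs]; rfl)
      rw [← hs, Function.update_eq_self] at s₁
      have hr' := s₁.steps.trans hr
      have hd : G.graph.degree x ≤ G.order := (G.graph.degree_lt_card_verts x).le
      have hcost : 1 + 2 * (G.graph.degree x - 1) + 2 ≤ baseCost G := by
        have := PortGraph.degree_pos h.symm
        unfold baseCost
        omega
      cases r with
      | true => exact explores_rejected hv h hs hcost hr' (hiff.1 rfl)
      | false =>
        exact explores_accepted ih hm hv h hs hcost hr' fun h' => Bool.false_ne_true (hiff.2 h')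
    · exact explores_finished h hs
    · exact absurd hs hx
  induction n with
  | zero =>
    intro σ v x hn hv h hx
    refine main σ v x hv h hx fun hs => ?_
    have : x ∈ Finset.univ.filter fun y => σ y = new := by simp [hs]
    rw [Finset.card_eq_zero.1 (Nat.le_zero.1 hn)] at this
    simp at this
  | succ n ih => exact fun σ v x hn hv h hx => main σ v x hv h hx fun _ => ⟨n, hn, ih⟩

/-- The output bit of a node. -/
def output : Mark → Bool
  | result b => b
  | _ => false

lemma forall_mem_of_closed (s : Set G.V) (v : G.V) (hv : v ∈ s)
    (h : ∀ y z, y ∈ s → G.graph.Adj y z → z ∈ s) (w : G.V) : w ∈ s := by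
  obtain ⟨p⟩ := G.connected.preconnected v w
  induction p with
  | nil => exact hv
  | cons hadj _ ih => exact ih (h _ _ hv hadj)

/-- With only the root on the path there are no active nodes, so no neighbour of the root stays new.
The nodes that are not new are then closed under adjacency. -/
lemma exists_steps_of_degree_pos (v : G.V) (hd : 0 < G.graph.degree v) :
    ∃ k ≤ nodeCost G * G.order + G.order * (baseCost G + 1) + 1, ∃ c,
      dfs.Steps k (dfs.start G v) c ∧ dfs.exitLen c = 0 ∧ (dfs.act c).2.1 = result G.order.bodd := by
  obtain ⟨σ, hσ⟩ : ∃ σ : G.V → Mark, σ = Function.update (fun _ => new) v (top true) := ⟨_, rfl⟩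
  have hσv : σ v = top true := by rw [hσ, Function.update_self]
  have hσ' : ∀ y, y ≠ v → σ y = new := fun y hy => by rw [hσ, Function.update_of_ne hy]
  have hnotact : ∀ y, ¬ IsActive (σ y) := by
    rintro y ⟨a, ha⟩
    by_cases hy : y = v
    · subst hy; rw [hσv] at ha; cases ha
    · rw [hσ' y hy] at ha; cases ha
  have hv : OnlyTop σ v := by
    refine ⟨⟨true, hσv⟩, fun y a hy => ?_, fun y b hy => ?_⟩
    · by_contra hne
      rw [hσ' y hne] at hy; cases hy
    · by_cases hyv : y = v
      · subst hyv; rw [hσv] at hy; cases hy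
      · rw [hσ' y hyv] at hy; cases hy
  have hnew : numNew σ + 1 = G.order := by
    rw [numNew_visit (σ := fun _ => new) (x := v) rfl (by simp [hσv])
      fun y hy => by simp [hσ' y hy]]
    simp [numNew, PortGraph.order]
  have hpar : parity σ = true := by
    unfold parity
    rw [← hnew, show numNew σ + 1 + numNew σ = 2 * numNew σ + 1 by ring]
    simp
  -- The neighbour at the last port: its cyclic successor is at port `0`, where the search begins.
  obtain ⟨u, hu⟩ : ∃ u, u = G.dest v ⟨G.graph.degree v - 1, by omega⟩ := ⟨_, rfl⟩
  have hadj : G.graph.Adj v u := hu ▸ G.adj_dest _ _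
  have hnum : G.num v u = G.graph.degree v - 1 := by rw [hu, G.num_dest]
  have hiter : ∀ i < G.graph.degree v, G.num v ((G.nxt v)^[i + 1] u) = i := by
    intro i hi
    rw [PortGraph.num_nxt_iterate hadj, hnum,
      show G.graph.degree v - 1 + (i + 1) = i + G.graph.degree v by omega, Nat.add_mod_right,
      Nat.mod_eq_of_lt hi]
  have hstart : dfs.Move (dfs.start G v) (sent v (G.nxt v u) (explore, parity σ) σ) := by
    have ha : dfs.act (dfs.start G v) = ((explore, true), top true, false, true) := by
      simp [act, start, dfs, portLen]
      exact decide_eq_true hd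
    refine move_iff.2 ⟨G.nxt v u, PortGraph.adj_nxt hadj, ?_, ?_⟩
    · have := hiter 0 hd
      rw [Function.iterate_one] at this
      rw [exitLen, ha]
      change _ = G.num v _ + 1
      rw [this]
      rfl
    · rw [ha, hpar, hσ]
      rfl
  obtain ⟨k, σ₁, hk, he, hnbr, hcost⟩ := explore_loop (exploresUpTo G (numNew σ)) le_rfl hadj hv
    (G.graph.degree v - 1) (fun j _ => hnotact _)
    (Or.inr fun j hj => by rw [hiter j (by omega)]; omega)
  rw [Nat.sub_add_cancel hd, PortGraph.nxt_iterate_degree hadj] at hk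
  -- The last neighbour is treated outside the loop because its reply ends the execution.
  obtain ⟨k', σ₂, hk', he', hx, hcost'⟩ := exploresUpTo G (numNew σ₁) σ₁ v u le_rfl
    (he.onlyTop hv) hadj fun h' => hnotact _ (he.isActive h')
  have he₂ := he.trans he'
  have h₂v : σ₂ v = top true := (he₂.old v (by simp [hσv])).trans hσv
  have hnbrv : ∀ z, G.graph.Adj v z → σ₂ z ≠ new := by
    intro z hz
    by_cases hzu : z = u
    · subst hzu
      exact hx.resolve_right fun ⟨a, _, ha⟩ => hnotact _ (he.isActive ha)
    · obtain ⟨j, hj, rfl⟩ := PortGraph.exists_nxt_iterate_succ hadj hz hzu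
      exact he'.ne_new ((hnbr j (by omega)).resolve_right fun ⟨a, _, ha⟩ => hnotact _ ha)
  have hall : ∀ w, σ₂ w ≠ new := by
    refine forall_mem_of_closed {y | σ₂ y ≠ new} v (by simp [h₂v]) fun y z hy hz => ?_
    by_cases hyv : y = v
    · subst hyv; exact hnbrv z hz
    · rcases he₂.fresh y (hσ' y hyv) with h' | h'
      · exact absurd h' hy
      · rcases he₂.nbr y z (hσ' y hyv) h' hz with h'' | ⟨a, haz, ha⟩
        · exact h''
        · have hav : a = v := by
            by_contra hav
            rw [hσ' a hav] at ha
            rcases ha with ⟨b, hb⟩ | ⟨b, hb⟩ <;> cases hb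
          subst hav
          exact hnbrv z haz.symm
  have hnew₂ : numNew σ₂ = 0 := by
    rw [numNew, Finset.card_eq_zero, Finset.filter_eq_empty_iff]
    exact fun w _ => hall w
  have hpar₂ : parity σ₂ = G.order.bodd := by rw [parity, hnew₂, add_zero]
  refine ⟨1 + (k + k'), ?_, _, hstart.steps.trans (hk.trans hk'), ?_⟩
  · have h₁ : (G.graph.degree v - 1) * (baseCost G + 1) + (baseCost G + 1) ≤
        G.order * (baseCost G + 1) := by
      rw [← Nat.succ_mul]
      have : G.graph.degree v < G.order := G.graph.degree_lt_card_verts v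
      exact Nat.mul_le_mul_right _ (by omega)
    have h₂ : nodeCost G * numNew σ ≤ nodeCost G * G.order := Nat.mul_le_mul_left _ (by omega)
    omega
  · have ha : dfs.act (sent u v (reply, parity σ₂) σ₂) =
        ((reply, parity σ₂), result (parity σ₂), false, false) := by
      have hmore : ¬ (G.num v u + 1 < G.graph.degree v) := by omega
      simp [act, sent, portLen, h₂v, dfs]
      exact decide_eq_false hmore
    rw [exitLen, ha, hpar₂]
    exact ⟨rfl, rfl⟩

lemma exists_steps_of_degree_eq_zero (v : G.V) (hd : G.graph.degree v = 0) :
    dfs.exitLen (dfs.start G v) = 0 ∧ (dfs.act (dfs.start G v)).2.1 = result G.order.bodd := by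
  have hone : G.order = 1 := by
    refine Fintype.card_eq_one_iff.2 ⟨v, fun w => ?_⟩
    refine forall_mem_of_closed {v} v rfl ?_ w
    rintro y z rfl hz
    exact absurd (PortGraph.degree_pos hz) (by omega)
  have ha : dfs.act (dfs.start G v) = ((reply, true), result true, false, false) := by
    simp [act, start, dfs, portLen]
    exact decide_eq_false (not_lt.2 hd.le)
  rw [exitLen, ha, hone]
  exact ⟨rfl, rfl⟩

end dfs

theorem parity_mem : Parity ∈ PAGTTheta (fun _ => 1) (fun _ => 1) := by
  refine mem_PAGTTheta dfs dfs.output rfl Parity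
    ((Polynomial.X * (2 * Polynomial.X + 2) + 2 * Polynomial.X + 5) * Polynomial.X +
      Polynomial.X * (2 * Polynomial.X + 2) + 1) fun G v => ?_
  have hG : ∀ s, s = result G.order.bodd → (G ∈ Parity ↔ dfs.output s = true) := by
    rintro s rfl
    change Odd G.order ↔ G.order.bodd = true
    rw [Nat.odd_iff, Nat.mod_two_of_bodd]
    cases G.order.bodd <;> simp
  rcases Nat.eq_zero_or_pos (G.graph.degree v) with hd | hd
  · obtain ⟨h₁, h₂⟩ := dfs.exists_steps_of_degree_eq_zero v hd
    exact ⟨0, Nat.zero_le _, _, rfl, h₁, hG _ h₂⟩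
  · obtain ⟨k, hk, c, hc, h₁, h₂⟩ := dfs.exists_steps_of_degree_pos v hd
    refine ⟨k, ?_, c, hc, h₁, hG _ h₂⟩
    simpa [dfs.nodeCost, dfs.baseCost, add_assoc] using hk

/-! ### Counting crossings on a path

The agent walks on the nodes `0, …, m`. The moves at each node are given by a word: `some true` is
a move from `i` to `i + 1`, `some false` is a move from `i` to `i - 1`, and `none` ends the walk. -/

/-- The number of moves upwards among the first `n` moves. -/
def ups (w : ℕ → Option Bool) (n : ℕ) : ℕ := Nat.count (fun t => w t = some true) n

/-- The number of moves downwards among the first `n` moves. -/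
def downs (w : ℕ → Option Bool) (n : ℕ) : ℕ := Nat.count (fun t => w t = some false) n

lemma ups_succ (w : ℕ → Option Bool) (n : ℕ) :
    ups w (n + 1) = ups w n + if w n = some true then 1 else 0 := Nat.count_succ ..

lemma downs_succ (w : ℕ → Option Bool) (n : ℕ) :
    downs w (n + 1) = downs w n + if w n = some false then 1 else 0 := Nat.count_succ ..

lemma downs_mono (w : ℕ → Option Bool) : Monotone (downs w) := Nat.count_monotone _

lemma encard_ups (w : ℕ → Option Bool) (n : ℕ) :
    {t | t < n ∧ w t = some true}.encard = ups w n := by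
  rw [ups, Nat.count_eq_card_filter_range, ← Set.encard_coe_eq_coe_finsetCard]
  congr 1
  ext t
  simp

/-- A walk that starts in node `m` has reached node `z` and has left node `i` for `a i` times. -/
structure WalkState (W : ℕ → ℕ → Option Bool) (m z : ℕ) (a : ℕ → ℕ) : Prop where
  le : z ≤ m
  proper : ∀ i ≤ m, ∀ t < a i, W i t ≠ none
  -- The walk starts above the edge from `i` to `i + 1`, so it has crossed this edge downwards once
  -- more than upwards exactly if it is now below.
  crossings : ∀ i < m, downs (W (i + 1)) (a (i + 1)) = ups (W i) (a i) + if z ≤ i then 1 else 0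
  last_down : ∀ i ≤ m, z < i → ∃ t, a i = t + 1 ∧ W i t = some false
  last_up : ∀ i < z, a i = 0 ∨ ∃ t, a i = t + 1 ∧ W i t = some true

namespace WalkState

variable {W : ℕ → ℕ → Option Bool} {m z : ℕ} {a : ℕ → ℕ}

lemma start (W : ℕ → ℕ → Option Bool) (m : ℕ) : WalkState W m m fun _ => 0 where
  le := le_rfl
  proper i _ t ht := absurd ht (Nat.not_lt_zero t)
  crossings i hi := by simp [downs, ups, hi]
  last_down i hi hi' := absurd hi (not_le.2 hi')
  last_up i _ := Or.inl rfl

lemma proper_update (h : WalkState W m z a) (hz : W z (a z) ≠ none) :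
    ∀ i ≤ m, ∀ t < Function.update a z (a z + 1) i, W i t ≠ none := by
  intro i hi t ht
  by_cases hiz : i = z
  · subst hiz
    rw [Function.update_self] at ht
    rcases Nat.lt_succ_iff_lt_or_eq.1 ht with ht | rfl
    · exact h.proper i hi t ht
    · exact hz
  · rw [Function.update_of_ne hiz] at ht
    exact h.proper i hi t ht

lemma up (h : WalkState W m z a) (hz : W z (a z) = some true) (hm : z < m) :
    WalkState W m (z + 1) (Function.update a z (a z + 1)) where
  le := hm
  proper := h.proper_update (by simp [hz])
  crossings i hi := by
    have := h.crossings i hi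
    by_cases h₁ : i = z
    · subst h₁
      rw [if_pos le_rfl] at this
      rw [Function.update_of_ne (by omega), Function.update_self, if_neg (by omega), ups_succ,
        if_pos hz, this]
    · have h₂ : (z + 1 ≤ i) = (z ≤ i) := by simp only [eq_iff_iff]; omega
      rw [Function.update_of_ne h₁]
      simp only [h₂]
      rw [← this]
      by_cases h₃ : i + 1 = z
      · subst h₃
        rw [Function.update_self, downs_succ, if_neg (by simp [hz]), add_zero]
      · rw [Function.update_of_ne h₃]
  last_down i hi hi' := by
    rw [Function.update_of_ne (by omega)]
    exact h.last_down i hi (by omega)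
  last_up i hi := by
    by_cases h₁ : i = z
    · subst h₁
      exact Or.inr ⟨a i, Function.update_self .., hz⟩
    · rw [Function.update_of_ne h₁]
      exact h.last_up i (by omega)

lemma down {z : ℕ} (h : WalkState W m (z + 1) a) (hz : W (z + 1) (a (z + 1)) = some false) :
    WalkState W m z (Function.update a (z + 1) (a (z + 1) + 1)) where
  le := (Nat.le_succ z).trans h.le
  proper := h.proper_update (by simp [hz])
  crossings i hi := by
    have := h.crossings i hi
    by_cases h₁ : i = z
    · subst h₁
      rw [if_neg (by omega)] at this
      rw [Function.update_self, Function.update_of_ne (by omega), if_pos le_rfl, downs_succ,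
        if_pos hz, this, add_zero]
    · have h₂ : (z + 1 ≤ i) = (z ≤ i) := by simp only [eq_iff_iff]; omega
      rw [Function.update_of_ne (show i + 1 ≠ z + 1 by omega), this]
      simp only [h₂]
      by_cases h₃ : i = z + 1
      · subst h₃
        rw [Function.update_self, ups_succ, if_neg (show ¬ W (z + 1) (a (z + 1)) = some true by simp [hz]),
          add_zero]
      · rw [Function.update_of_ne h₃]
  last_down i hi hi' := by
    by_cases h₁ : i = z + 1
    · subst h₁
      exact ⟨a (z + 1), Function.update_self .., hz⟩
    · rw [Function.update_of_ne h₁]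
      exact h.last_down i hi (by omega)
  last_up i hi := by
    rw [Function.update_of_ne (by omega)]
    exact h.last_up i (by omega)

end WalkState

/-- If the walk ends when it has entered the nodes below some node for the `T`-th time, then it
ends when it has entered that node, with the word `w`, from above for the `entryBound w T`-th
time. -/
noncomputable def entryBound (w : ℕ → Option Bool) (T : ℕ∞) : ℕ∞ :=
  -- These are the moves upwards before the word ends and before the `T`-th move downwards. Each of
  -- them ends one visit to the part below; the added one is the visit that never ends.
  {t | w t = some true ∧ ∀ s ≤ t, w s ≠ none ∧ (w s = some false → (downs w s + 1 : ℕ) < T)}.encard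
    + 1

lemma entryBound_mono (w : ℕ → Option Bool) : Monotone (entryBound w) := fun _ _ h =>
  add_le_add (Set.encard_le_encard (fun _ ht =>
    ⟨ht.1, fun s hs => ⟨(ht.2 s hs).1, fun h' => ((ht.2 s hs).2 h').trans_le h⟩⟩)) le_rfl

/-- The number of entries from above into the nodes `0, …, i` after which the walk ends there, if
node `0` has the word `w₀` and the nodes `1, …, i` have the word `w₁`. -/
noncomputable def entries (w₀ w₁ : ℕ → Option Bool) : ℕ → ℕ∞
  | 0 => entryBound w₀ ⊤
  | i + 1 => entryBound w₁ (entries w₀ w₁ i)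

/-- The iterates of a monotone map keep the direction of their first step. -/
lemma entries_monotone_or_antitone (w₀ w₁ : ℕ → Option Bool) :
    Monotone (entries w₀ w₁) ∨ Antitone (entries w₀ w₁) := by
  rcases le_total (entries w₀ w₁ 0) (entries w₀ w₁ 1) with h | h
  · refine Or.inl (monotone_nat_of_le_succ fun n => ?_)
    induction n with
    | zero => exact h
    | succ n ih => exact entryBound_mono w₁ ih
  · refine Or.inr (antitone_nat_of_succ_le fun n => ?_)
    induction n with
    | zero => exact h
    | succ n ih => exact entryBound_mono w₁ ih

/-- The words on a path with the nodes `0, …, m`. -/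
def pathWords (w₀ w₁ w₂ : ℕ → Option Bool) (m i : ℕ) : ℕ → Option Bool :=
  if i = 0 then w₀ else if i = m then w₂ else w₁

namespace WalkState

variable {w₀ w₁ w₂ : ℕ → Option Bool} {m z : ℕ} {a : ℕ → ℕ}

/-- A move upwards from node `i + 1` shows that the walk has come back from every earlier descent to
node `i`. By induction these descents are too few to end the walk below. -/
lemma ups_lt_entries (h : WalkState (pathWords w₀ w₁ w₂ m) m z a)
    (h₀ : ∀ t, w₀ t ≠ some false) {i : ℕ} (hi : i < m) :
    ((ups (pathWords w₀ w₁ w₂ m i) (a i) + 1 : ℕ) : ℕ∞) ≤ entries w₀ w₁ i := by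
  induction i with
  | zero =>
    have hw : pathWords w₀ w₁ w₂ m 0 = w₀ := if_pos rfl
    rw [Nat.cast_succ, ← encard_ups, hw]
    refine add_le_add (Set.encard_le_encard (fun t ht => ⟨ht.2, fun s hs => ⟨?_, ?_⟩⟩)) le_rfl
    · rw [← hw]
      exact h.proper 0 (by omega) s (lt_of_le_of_lt hs ht.1)
    · exact fun h' => absurd h' (h₀ s)
  | succ i ih =>
    have hw : pathWords w₀ w₁ w₂ m (i + 1) = w₁ := by
      rw [pathWords, if_neg (by omega), if_neg (by omega)]
    have hc := h.crossings i (by omega)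
    have hl := h.last_down (i + 1) (by omega)
    rw [Nat.cast_succ, ← encard_ups]
    rw [hw] at hc hl ⊢
    refine add_le_add (Set.encard_le_encard (fun t ht => ⟨ht.2, fun s hs => ⟨?_, ?_⟩⟩)) le_rfl
    · rw [← hw]
      exact h.proper (i + 1) (by omega) s (lt_of_le_of_lt hs ht.1)
    · intro hs'
      refine lt_of_lt_of_le ?_ (ih (by omega))
      rw [Nat.cast_lt]
      have h₁ : downs w₁ (s + 1) = downs w₁ s + 1 := by rw [downs_succ, if_pos hs']
      have hst : s < t := lt_of_le_of_ne hs (by rintro rfl; rw [ht.2] at hs'; simp at hs')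
      have hta := ht.1
      by_cases hz : z ≤ i
      -- The walk is below, and only the last move `t'` of node `i + 1` has not been returned from;
      -- the descent `s` is earlier.
      · obtain ⟨t', ht', hw'⟩ := hl (by omega)
        have htt : t ≠ t' := by rintro rfl; rw [ht.2] at hw'; simp at hw'
        have h₂ : downs w₁ (s + 1) ≤ downs w₁ t' := downs_mono w₁ (by omega)
        rw [ht', downs_succ, if_pos hw', if_pos hz] at hc
        omega
      · have h₂ : downs w₁ (s + 1) ≤ downs w₁ (a (i + 1)) := downs_mono w₁ (by omega)
        rw [if_neg hz] at hc
        omega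

/-- The walk has halted at or below node `i`. A further move upwards counted in `entries` would come
after the end of the word or after the fatal descent, which the definition of `entryBound` excludes.
-/
lemma entries_eq (h : WalkState (pathWords w₀ w₁ w₂ m) m z a)
    (h₀ : ∀ t, w₀ t ≠ some false) (hz : pathWords w₀ w₁ w₂ m z (a z) = none) {i : ℕ} (hi : i < m)
    (hzi : z ≤ i) :
    entries w₀ w₁ i = ((ups (pathWords w₀ w₁ w₂ m i) (a i) + 1 : ℕ) : ℕ∞) := by
  refine le_antisymm ?_ (h.ups_lt_entries h₀ hi)
  induction i with
  | zero =>
    obtain rfl : z = 0 := by omega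
    have hw : pathWords w₀ w₁ w₂ m 0 = w₀ := if_pos rfl
    rw [hw] at hz ⊢
    rw [Nat.cast_succ, ← encard_ups]
    refine add_le_add (Set.encard_le_encard (fun t ht => ⟨?_, ht.1⟩)) le_rfl
    by_contra hta
    exact (ht.2 (a 0) (not_lt.1 hta)).1 hz
  | succ i ih =>
    have hw : pathWords w₀ w₁ w₂ m (i + 1) = w₁ := by
      rw [pathWords, if_neg (by omega), if_neg (by omega)]
    rw [Nat.cast_succ, ← encard_ups]
    refine add_le_add (Set.encard_le_encard (fun t ht => ⟨?_, by rw [hw]; exact ht.1⟩)) le_rfl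
    by_contra hta
    rcases hzi.eq_or_lt with rfl | hzi
    · rw [hw] at hz
      exact (ht.2 _ (not_lt.1 hta)).1 hz
    · obtain ⟨t', ht', hw'⟩ := h.last_down (i + 1) (by omega) hzi
      have hc := h.crossings i (by omega)
      rw [hw] at hw' hc
      rw [ht', downs_succ, if_pos hw', if_pos (by omega)] at hc
      have h₁ := (ht.2 t' (by omega)).2 hw'
      rw [hc] at h₁
      exact absurd (ih (by omega) (by omega)) (not_le.2 h₁)

lemma downs_last (hm : 0 < m) (h : WalkState (pathWords w₀ w₁ w₂ m) m z a)
    (h₂ : ∀ t, w₂ t ≠ some true) : downs w₂ (a m) = a m := by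
  have hw : pathWords w₀ w₁ w₂ m m = w₂ := by rw [pathWords, if_neg hm.ne', if_pos rfl]
  rw [downs, Nat.count_iff_forall]
  intro t ht
  have h₁ := h.proper m le_rfl t ht
  rw [hw] at h₁
  have h₂ := h₂ t
  cases hwt : w₂ t with
  | none => exact absurd hwt h₁
  | some b => cases b <;> simp_all

/-- The walk on a path of length `m` ends in the starting node if and only if the number of moves
from there is less than the number of entries after which it ends elsewhere. -/
lemma end_eq_iff (hm : 0 < m) (h : WalkState (pathWords w₀ w₁ w₂ m) m z a)
    (h₀ : ∀ t, w₀ t ≠ some false) (h₂ : ∀ t, w₂ t ≠ some true)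
    (hz : pathWords w₀ w₁ w₂ m z (a z) = none) :
    z = m ↔ {t | ∀ s ≤ t, w₂ s ≠ none}.encard < entries w₀ w₁ (m - 1) := by
  have hw : pathWords w₀ w₁ w₂ m m = w₂ := by rw [pathWords, if_neg hm.ne', if_pos rfl]
  have hd := h.downs_last hm h₂
  have hc := h.crossings (m - 1) (by omega)
  rw [Nat.sub_add_cancel hm, hw, hd] at hc
  have hI : {t | t < a m}.encard = a m := by
    rw [← Finset.card_range (a m), ← Set.encard_coe_eq_coe_finsetCard]
    congr 1
    ext t
    simp
  have hsub : {t | t < a m} ⊆ {t | ∀ s ≤ t, w₂ s ≠ none} := fun t ht s hs => by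
    have := h.proper m le_rfl s (lt_of_le_of_lt hs ht)
    rwa [hw] at this
  constructor
  · rintro rfl
    rw [hw] at hz
    have : {t | ∀ s ≤ t, w₂ s ≠ none} = {t | t < a z} := by
      refine Set.Subset.antisymm (fun t ht => ?_) hsub
      by_contra hta
      exact ht _ (not_lt.1 hta) hz
    rw [this, hI]
    refine lt_of_lt_of_le ?_ (h.ups_lt_entries h₀ (by omega))
    rw [if_neg (by omega)] at hc
    rw [Nat.cast_lt]
    omega
  · intro hlt
    by_contra hne
    have hle := h.le
    rw [h.entries_eq h₀ hz (i := m - 1) (by omega) (by omega)] at hlt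
    rw [if_pos (by omega)] at hc
    rw [← hc, ← hI] at hlt
    exact absurd (Set.encard_le_encard hsub) (not_le.2 hlt)

/-- If a walk ends in an inner node, then no walk on a path with that inner node ends in node
`0`. -/
lemma end_ne_zero {m' : ℕ} {a' : ℕ → ℕ} (h : WalkState (pathWords w₀ w₁ w₂ m) m z a)
    (h' : WalkState (pathWords w₀ w₁ w₂ m') m' 0 a') (h₀ : ∀ t, w₀ t ≠ some false)
    (hz : pathWords w₀ w₁ w₂ m z (a z) = none) (hz' : pathWords w₀ w₁ w₂ m' 0 (a' 0) = none)
    (h0z : 0 < z) (hzm : z < m) (hzm' : z < m') : False := by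
  obtain ⟨i, rfl⟩ := Nat.exists_eq_add_of_lt h0z
  rw [zero_add] at *
  have hw : pathWords w₀ w₁ w₂ m (i + 1) = w₁ := by
    rw [pathWords, if_neg (by omega), if_neg (by omega)]
  have hw' : pathWords w₀ w₁ w₂ m' (i + 1) = w₁ := by
    rw [pathWords, if_neg (by omega), if_neg (by omega)]
  have hc := h.crossings i (by omega)
  have hc' := h'.crossings i (by omega)
  rw [hw, if_neg (by omega)] at hc
  rw [hw', if_pos (by omega)] at hc'
  have h₁ := h.ups_lt_entries h₀ (i := i) (by omega)
  rw [h'.entries_eq h₀ hz' (by omega) (Nat.zero_le i), ← hc', Nat.cast_le] at h₁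
  -- The inner word ends at index `a (i + 1)`, so the other walk cannot use more of it. Its fatal
  -- descent to node `i` would thus also have occurred in the first walk, which came back from all
  -- of its descents.
  have hle : a' (i + 1) ≤ a (i + 1) := by
    by_contra hlt
    have := h'.proper (i + 1) (by omega) _ (not_le.1 hlt)
    rw [hw'] at this
    rw [hw] at hz
    exact this hz
  have := downs_mono w₁ hle
  omega

end WalkState

/-- The parity of the length of a path is not determined by the kind of the node (node `0`, inner
node, or starting node) where a walk with given words ends. -/
theorem not_forall_end_kind {w₀ w₁ w₂ : ℕ → Option Bool} (h₀ : ∀ t, w₀ t ≠ some false)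
    (h₂ : ∀ t, w₂ t ≠ some true) (z : ℕ → ℕ) (a : ℕ → ℕ → ℕ)
    (h : ∀ m, 0 < m → WalkState (pathWords w₀ w₁ w₂ m) m (z m) (a m))
    (hz : ∀ m, 0 < m → pathWords w₀ w₁ w₂ m (z m) (a m (z m)) = none)
    (hpar : ∀ m m', 0 < m → 0 < m' → (z m = 0 ↔ z m' = 0) → (z m = m ↔ z m' = m') →
      (Odd (m + 1) ↔ Odd (m' + 1))) : False := by
  have hle : ∀ m, 0 < m → z m ≤ m := fun m hm => (h m hm).le
  have hiff := fun m hm => (h m hm).end_eq_iff hm h₀ h₂ (hz m hm)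
  have hnext : ∀ m, 0 < m → (z m = 0 ↔ z (m + 1) = 0) → (z m = m ↔ z (m + 1) = m + 1) →
      False := by
    intro m hm h₁ h₂
    have := hpar m (m + 1) hm (by omega) h₁ h₂
    rw [Nat.odd_add_one (n := m + 1)] at this
    tauto
  have hA : ∀ m, 0 < m → z m = m → z (m + 1) = m + 1 → False := fun m hm h₁ h₂ =>
    hnext m hm (by omega) (by omega)
  have hin : ∀ m m', 0 < m → m ≤ m' → z m ≠ 0 → z m ≠ m → z m' ≠ 0 := by
    intro m m' hm hmm h₁ h₂ h₃
    have h' := h m' (by omega)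
    have hz' := hz m' (by omega)
    rw [h₃] at h' hz'
    have := hle m hm
    exact (h m hm).end_ne_zero h' h₀ (hz m hm) hz' (by omega) (by omega) (by omega)
  -- Away from the start only two kinds remain, and the change from an inner node to node `0` is
  -- impossible, so the kind cannot alternate over three lengths.
  have hB : ∀ m, 0 < m → z m ≠ m → z (m + 1) ≠ m + 1 → z (m + 2) ≠ m + 2 → False := by
    intro m hm h₁ h₂ h₃
    by_cases hm0 : z m = 0
    · by_cases hm1 : z (m + 1) = 0
      · exact hnext m hm (by simp [hm0, hm1]) (by simp [h₁, h₂])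
      · have := hin (m + 1) (m + 2) (by omega) (by omega) hm1 h₂
        exact hnext (m + 1) (by omega) (by simp [hm1, this]) (by simp [h₂, h₃])
    · have := hin m (m + 1) hm (by omega) hm0 h₁
      exact hnext m hm (by simp [hm0, this]) (by simp [h₁, h₂])
  -- The lengths `2, 3, 4` leave room for two consecutive lengths on either side: `4, 5` in the
  -- monotone case and `1, 2` in the antitone case.
  refine hB 2 (by omega) ?_ ?_ ?_ <;>
  · intro hend
    rw [hiff _ (by omega)] at hend
    rcases entries_monotone_or_antitone w₀ w₁ with hmon | hmon
    · exact hA 4 (by omega) ((hiff 4 (by omega)).2 (hend.trans_le (hmon (by omega))))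
        ((hiff 5 (by omega)).2 (hend.trans_le (hmon (by omega))))
    · exact hA 1 (by omega) ((hiff 1 (by omega)).2 (hend.trans_le (hmon (by omega))))
        ((hiff 2 (by omega)).2 (hend.trans_le (hmon (by omega))))

/-! ### Paths as input graphs -/

open Classical in
/-- The path with the nodes `0, …, m`. At an inner node, port `0` leads downwards and port `1` leads
upwards. -/
noncomputable def pathG (m : ℕ) : PortGraph where
  V := Fin (m + 1)
  graph := SimpleGraph.pathGraph (m + 1)
  connected := SimpleGraph.pathGraph_connected m
  port v := Equiv.ofBijective
    (fun u => ⟨if v < u.1 ∧ 0 < v.1 then 1 else 0, by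
      have hu := u.2
      rw [← SimpleGraph.card_neighborFinset_eq_degree]
      split_ifs with h
      · rw [Finset.one_lt_card]
        have hv : v.1 - 1 < m + 1 := by omega
        refine ⟨u, (SimpleGraph.mem_neighborFinset _ _ _).2 hu, ⟨v.1 - 1, hv⟩, ?_, ?_⟩
        · rw [SimpleGraph.mem_neighborFinset, SimpleGraph.pathGraph_adj]
          simp only
          omega
        · have := h.1
          rw [Fin.lt_def] at this
          rw [Ne, Fin.ext_iff]
          simp only
          omega
      · exact Finset.card_pos.2 ⟨u, (SimpleGraph.mem_neighborFinset _ _ _).2 hu⟩⟩ :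
      (SimpleGraph.pathGraph (m + 1)).neighborSet v →
        Fin ((SimpleGraph.pathGraph (m + 1)).degree v))
    ((Fintype.bijective_iff_injective_and_card _).2 ⟨fun u u' h => by
      have hu := u.2
      have hu' := u'.2
      rw [SimpleGraph.mem_neighborSet, SimpleGraph.pathGraph_adj] at hu hu'
      rw [Fin.mk.injEq] at h
      simp only [Fin.lt_def] at h
      rw [Subtype.ext_iff, Fin.ext_iff]
      split_ifs at h <;> omega, by
        rw [SimpleGraph.card_neighborSet_eq_degree, Fintype.card_fin]⟩)

lemma pathG_order (m : ℕ) : (pathG m).order = m + 1 := Fintype.card_fin _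

/-- The number of a node of a path. -/
def pathVal {m : ℕ} (v : (pathG m).V) : ℕ := Fin.val (n := m + 1) v

lemma pathVal_le {m : ℕ} (v : (pathG m).V) : pathVal v ≤ m :=
  Nat.le_of_lt_succ (Fin.isLt (n := m + 1) v)

lemma pathVal_inj {m : ℕ} {u v : (pathG m).V} : pathVal u = pathVal v ↔ u = v :=
  Fin.val_inj (n := m + 1)

/-- The node with number `i`. -/
def pathNode {m i : ℕ} (h : i ≤ m) : (pathG m).V := (⟨i, Nat.lt_succ_of_le h⟩ : Fin (m + 1))

@[simp] lemma pathVal_pathNode {m i : ℕ} (h : i ≤ m) : pathVal (pathNode h) = i := rfl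

lemma pathG_adj {m : ℕ} {u v : (pathG m).V} :
    (pathG m).graph.Adj u v ↔ pathVal u + 1 = pathVal v ∨ pathVal v + 1 = pathVal u :=
  SimpleGraph.pathGraph_adj

lemma pathG_num {m : ℕ} {v u : (pathG m).V} (h : (pathG m).graph.Adj v u) :
    (pathG m).num v u = if pathVal v < pathVal u ∧ 0 < pathVal v then 1 else 0 := by
  rw [PortGraph.num_eq _ h]
  rfl

lemma PortGraph.degree_eq_card (G : PortGraph) (v : G.V) (s : Finset G.V)
    (h : ∀ u, G.graph.Adj v u ↔ u ∈ s) : G.graph.degree v = s.card := by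
  rw [← SimpleGraph.card_neighborFinset_eq_degree]
  congr 1
  ext u
  rw [SimpleGraph.mem_neighborFinset, h]

lemma pathG_degree {m : ℕ} (hm : 0 < m) (v : (pathG m).V) :
    (pathG m).graph.degree v = if pathVal v = 0 ∨ pathVal v = m then 1 else 2 := by
  have hv := pathVal_le v
  by_cases h0 : pathVal v = 0
  · rw [if_pos (Or.inl h0)]
    refine ((pathG m).degree_eq_card v {pathNode (i := 1) hm} fun u => ?_).trans
      (Finset.card_singleton _)
    rw [pathG_adj, Finset.mem_singleton, ← pathVal_inj, pathVal_pathNode]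
    omega
  · by_cases h1 : pathVal v = m
    · rw [if_pos (Or.inr h1)]
      refine ((pathG m).degree_eq_card v {pathNode (i := m - 1) (by omega)} fun u => ?_).trans
        (Finset.card_singleton _)
      have hu := pathVal_le u
      rw [pathG_adj, Finset.mem_singleton, ← pathVal_inj, pathVal_pathNode]
      omega
    · rw [if_neg (by omega)]
      refine ((pathG m).degree_eq_card v {pathNode (i := pathVal v - 1) (by omega),
        pathNode (i := pathVal v + 1) (by omega)} fun u => ?_).trans (Finset.card_pair ?_)
      · rw [pathG_adj, Finset.mem_insert, Finset.mem_singleton, ← pathVal_inj, ← pathVal_inj,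
          pathVal_pathNode, pathVal_pathNode]
        omega
      · rw [Ne, ← pathVal_inj, pathVal_pathNode, pathVal_pathNode]
        omega

/-! ### Agents without memory on paths -/

section NoMemory

variable (A : Algorithm)

/-- The initial Turing machine configuration of an agent without memory at a node with storage `s`
and degree `d`, entered by port `p`. -/
def nodeInit (s : TapeContents) (d : ℕ) (p : Option ℕ) : TMConfig A where
  state := A.q₀
  tape := ![zeroTape, s, unaryTape d, portTape p, blankTape]
  head := fun _ => 0

/-- The local computation of an agent without memory ends with `r`. -/
def NodeResult (d : ℕ) (x : TapeContents × Option ℕ) (r : TMConfig A) : Prop :=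
  ∃ t : ℕ, A.tmStep^[t] (nodeInit A x.1 d x.2) = r ∧ r.state = A.q₁

variable {A}

lemma localResult_iff {G : PortGraph} {c : AgentConfig G} (h : c.mem = zeroTape)
    (r : TMConfig A) :
    A.LocalResult c r ↔ NodeResult A (G.graph.degree c.loc) (c.sto c.loc, c.inPort) r := by
  obtain ⟨v, p, mem, σ⟩ := c
  subst h
  rfl

lemma NodeResult.unique {d : ℕ} {x : TapeContents × Option ℕ} {r r' : TMConfig A}
    (h : NodeResult A d x r) (h' : NodeResult A d x r') : r = r' := by
  obtain ⟨t, rfl, hs⟩ := h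
  obtain ⟨t', rfl, hs'⟩ := h'
  exact Controller.tmStep_iterate_unique hs hs'

variable (A)

open Classical in
/-- The new storage and the exit port, if the agent leaves the node. -/
noncomputable def nodeStep (d : ℕ) (x : TapeContents × Option ℕ) : Option (TapeContents × ℕ) :=
  if h : ∃ y : TMConfig A × ℕ, NodeResult A d x y.1 ∧ y.1.tape outTape = portTape (some y.2) ∧
    y.2 < d then some (h.choose.1.tape stoTape, h.choose.2) else none

variable {A}

lemma nodeStep_eq_some {d : ℕ} {x : TapeContents × Option ℕ} {r : TMConfig A} {p : ℕ}
    (h : NodeResult A d x r) (hp : r.tape outTape = portTape (some p)) (hd : p < d) :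
    nodeStep A d x = some (r.tape stoTape, p) := by
  have hex : ∃ y : TMConfig A × ℕ, NodeResult A d x y.1 ∧
    y.1.tape outTape = portTape (some y.2) ∧ y.2 < d := ⟨(r, p), h, hp, hd⟩
  obtain ⟨h₁, h₂, -⟩ := hex.choose_spec
  have hr := h₁.unique h
  rw [nodeStep, dif_pos hex, hr]
  rw [hr, hp] at h₂
  have := unaryTape_injective h₂
  simp only [Option.some.injEq, Prod.mk.injEq, true_and]
  omega

lemma nodeStep_eq_none {d : ℕ} {x : TapeContents × Option ℕ} {r : TMConfig A}
    (h : NodeResult A d x r) (hp : r.tape outTape = blankTape) : nodeStep A d x = none := by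
  refine dif_neg ?_
  rintro ⟨⟨r', p⟩, h', hp', -⟩
  obtain rfl := h.unique h'
  rw [hp, blankTape_eq] at hp'
  have := unaryTape_injective hp'
  omega

lemma nodeStep_lt {d : ℕ} {x : TapeContents × Option ℕ} {y : TapeContents × ℕ}
    (h : nodeStep A d x = some y) : y.2 < d := by
  unfold nodeStep at h
  split_ifs at h with hex
  obtain rfl := Option.some_injective _ h
  exact hex.choose_spec.2.2

variable (A)

/-- The storage of a node and the port by which the agent enters it for the next time, after `t`
visits, if the agent always returns through the port by which it has left. The node has degree
`κ.1`, and `κ.2` is the port by which the agent enters it for the first time. -/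
noncomputable def nodeSeq (κ : ℕ × Option ℕ) : ℕ → TapeContents × Option ℕ
  | 0 => (zeroTape, κ.2)
  -- If the agent does not leave, the pair stays the same, so the word is `none` from then on.
  | t + 1 => ((nodeStep A κ.1 (nodeSeq κ t)).map fun y => (y.1, some y.2)).getD (nodeSeq κ t)

/-- The end of a path that is not the starting node. -/
abbrev endKind : ℕ × Option ℕ := (1, some 0)
/-- An inner node of a path, which is entered from above for the first time. -/
abbrev innerKind : ℕ × Option ℕ := (2, some 1)
/-- The end of a path that is the starting node. -/
abbrev startKind : ℕ × Option ℕ := (1, none)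

/-- Whether port `p` leads upwards. -/
def isUp (κ : ℕ × Option ℕ) (p : ℕ) : Bool := decide (κ = endKind ∨ κ = innerKind ∧ p ≠ 0)

/-- The moves from a node of a path. -/
noncomputable def nodeWord (κ : ℕ × Option ℕ) (t : ℕ) : Option Bool :=
  (nodeStep A κ.1 (nodeSeq A κ t)).map fun y => isUp κ y.2

/-- The kinds of the nodes of a path. -/
def kind (m i : ℕ) : ℕ × Option ℕ :=
  if i = 0 then endKind else if i = m then startKind else innerKind

/-- The words of the moves on a path. -/
noncomputable abbrev agentWords : ℕ → ℕ → ℕ → Option Bool :=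
  pathWords (nodeWord A endKind) (nodeWord A innerKind) (nodeWord A startKind)

lemma agentWords_eq (m i : ℕ) : agentWords A m i = nodeWord A (kind m i) := by
  unfold agentWords pathWords kind
  split_ifs <;> rfl

lemma kind_fst {m : ℕ} (hm : 0 < m) (v : (pathG m).V) :
    (kind m (pathVal v)).1 = (pathG m).graph.degree v := by
  rw [pathG_degree hm, kind]
  split_ifs <;> first | rfl | omega

variable {A}

/-- The next entry port is the last exit port, and only the upward port of an inner node is `1`. -/
lemma nodeSeq_of_nodeWord {m i t : ℕ} {b : Bool} (h : nodeWord A (kind m i) t = some b) :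
    (nodeSeq A (kind m i) (t + 1)).2 = some (if b = true ∧ 0 < i then 1 else 0) := by
  obtain ⟨y, hy, hb⟩ := Option.map_eq_some_iff.1 h
  have hlt := nodeStep_lt hy
  rw [nodeSeq, hy]
  simp only [Option.map_some, Option.getD_some, Option.some.injEq]
  subst hb
  unfold kind at hlt ⊢
  split_ifs at hlt ⊢ <;> (simp_all [isUp]; try omega)

lemma mem_eq_zeroTape (hA : A.TapeBound memTape fun _ => 0) {G : PortGraph} {v : G.V} {k : ℕ} {c : AgentConfig G} {r : TMConfig A}
    (h : A.ReachesIn G v k c) (hr : A.LocalResult c r) : r.tape memTape = zeroTape := by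
  obtain ⟨t, rfl, -⟩ := hr
  obtain ⟨-, h', -⟩ := hA G.order G le_rfl v k c h t
  funext i
  exact h' i (lt_or_ge i 0)

/-- The agent configuration `c` on a path after `a i` moves from node `i`. -/
structure PathConfig {m : ℕ} (c : AgentConfig (pathG m)) (a : ℕ → ℕ) : Prop where
  walk : WalkState (agentWords A m) m (pathVal c.loc) a
  mem : c.mem = zeroTape
  sto : ∀ v, c.sto v = (nodeSeq A (kind m (pathVal v)) (a (pathVal v))).1
  inPort : c.inPort = (nodeSeq A (kind m (pathVal c.loc)) (a (pathVal c.loc))).2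

lemma PathConfig.nodeResult_iff {m : ℕ} (hm : 0 < m) {c : AgentConfig (pathG m)} {a : ℕ → ℕ}
    (h : PathConfig (A := A) c a) (r : TMConfig A) : A.LocalResult c r ↔
      NodeResult A (kind m (pathVal c.loc)).1
        (nodeSeq A (kind m (pathVal c.loc)) (a (pathVal c.loc))) r := by
  rw [localResult_iff h.mem, kind_fst hm, h.sto, h.inPort]

/-- On a path the agent re-enters a node over the edge by which it last left it, which is the
assumption built into `nodeSeq`. -/
lemma exists_pathConfig (hA : A.TapeBound memTape fun _ => 0) {m : ℕ} (hm : 0 < m) (k : ℕ) (c : AgentConfig (pathG m))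
    (h : A.ReachesIn (pathG m) (pathNode le_rfl) k c) : ∃ a, PathConfig (A := A) c a := by
  induction k generalizing c with
  | zero =>
    obtain rfl := h
    refine ⟨fun _ => 0, WalkState.start _ m, rfl, fun _ => rfl, ?_⟩
    simp [AgentConfig.start, nodeSeq, kind, hm.ne']
  | succ k ih =>
    obtain ⟨c, hc, r, hr, p, hp, rfl⟩ := h
    obtain ⟨a, ha⟩ := ih c hc
    have hmem := mem_eq_zeroTape hA hc hr
    have hadj := (pathG m).adj_dest c.loc p
    have hnum : (p : ℕ) = _ := ((pathG m).num_dest c.loc p).symm.trans (pathG_num hadj)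
    have hentry := ((pathG m).entry_eq c.loc p).trans (pathG_num hadj.symm)
    have hle := pathVal_le ((pathG m).dest c.loc p)
    have hstep := nodeStep_eq_some ((ha.nodeResult_iff hm r).1 hr) hp (by
      rw [kind_fst hm]
      exact p.2)
    rw [pathG_adj] at hadj
    obtain ⟨q, hq⟩ : ∃ q, q = ((pathG m).entry c.loc p : ℕ) := ⟨_, rfl⟩
    rw [← hq] at hentry ⊢
    obtain ⟨w, hw⟩ : ∃ w, w = (pathG m).dest c.loc p := ⟨_, rfl⟩
    rw [← hw] at hadj hnum hentry hle
    have hsto : ∀ v, Function.update c.sto c.loc (r.tape stoTape) v =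
        (nodeSeq A (kind m (pathVal v))
          (Function.update a (pathVal c.loc) (a (pathVal c.loc) + 1) (pathVal v))).1 := by
      intro v
      by_cases hv : v = c.loc
      · subst hv
        rw [Function.update_self, Function.update_self, nodeSeq, hstep]
        rfl
      · rw [Function.update_of_ne hv, Function.update_of_ne (by rwa [Ne, pathVal_inj]), ha.sto]
    have hword : agentWords A m (pathVal c.loc) (a (pathVal c.loc)) =
        some (isUp (kind m (pathVal c.loc)) p) := by
      rw [agentWords_eq, nodeWord, hstep]
      rfl
    refine ⟨Function.update a (pathVal c.loc) (a (pathVal c.loc) + 1), ?_, hmem, hsto, ?_⟩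
    · change WalkState _ _ (pathVal ((pathG m).dest c.loc p)) _
      rw [← hw]
      rcases hadj with hadj | hadj
      · rw [← hadj]
        refine ha.walk.up (hword.trans ?_) (by omega)
        rw [hnum]
        unfold kind
        split_ifs <;> (simp_all [isUp]; try omega)
      · have hwalk := ha.walk
        rw [← hadj] at hwalk hword ⊢
        refine hwalk.down (hword.trans ?_)
        rw [hnum]
        unfold kind
        split_ifs <;> (simp_all [isUp]; try omega)
    · change some _ = (nodeSeq A (kind m (pathVal ((pathG m).dest c.loc p)))
        (Function.update a _ _ (pathVal ((pathG m).dest c.loc p)))).2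
      rw [← hw, hentry, Function.update_of_ne (by omega)]
      -- When the agent enters `w` from below, the last move from `w` was downwards. When it enters
      -- from above, this is the first visit or the last move was upwards.
      rcases hadj with hadj | hadj
      · obtain ⟨t, ht, hwt⟩ := ha.walk.last_down (pathVal w) hle (by omega)
        rw [agentWords_eq] at hwt
        rw [ht, nodeSeq_of_nodeWord hwt, if_neg (by omega), if_neg (by simp)]
      · rcases ha.walk.last_up (pathVal w) (by omega) with ht | ⟨t, ht, hwt⟩
        · have := pathVal_le c.loc
          rw [ht, nodeSeq, kind]
          split_ifs <;> first | rfl | omega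
        · rw [agentWords_eq] at hwt
          rw [ht, nodeSeq_of_nodeWord hwt]
          simp only [true_and, show pathVal w < pathVal c.loc by omega]

end NoMemory

lemma kind_eq_iff {m m' z z' : ℕ} (hm : 0 < m) (hm' : 0 < m') (h₀ : z = 0 ↔ z' = 0)
    (h₁ : z = m ↔ z' = m') : kind m z = kind m' z' := by
  unfold kind
  split_ifs <;> first | rfl | omega

/-- The kind of the final node determines its word and the sequence of its storages, hence also the
output. -/
theorem parity_notMem_PAGT (h : ℕ → ℕ) : Parity ∉ PAGT (fun _ => 0) h := by
  rintro ⟨A, hsolves, -, hA, -⟩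
  have key : ∀ m, ∃ z a, 0 < m → WalkState (agentWords A m) m z a ∧
      agentWords A m z (a z) = none ∧ ∃ r,
      NodeResult A (kind m z).1 (nodeSeq A (kind m z) (a z)) r ∧
      (Odd (m + 1) ↔ r.tape stoTape 0 = some true) := by
    intro m
    rcases Nat.eq_zero_or_pos m with rfl | hm
    · exact ⟨0, fun _ => 0, fun h => absurd h (lt_irrefl 0)⟩
    obtain ⟨k, c, r, hk, ⟨hr, hblank⟩, hyes, hno⟩ := hsolves (pathG m) (pathNode le_rfl)
    obtain ⟨a, ha⟩ := exists_pathConfig hA hm k c hk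
    have hres := (ha.nodeResult_iff hm r).1 hr
    refine ⟨pathVal c.loc, a, fun _ => ⟨ha.walk, ?_, r, hres, ?_⟩⟩
    · rw [agentWords_eq, nodeWord, nodeStep_eq_none hres hblank]
      rfl
    · have hmem : pathG m ∈ Parity ↔ Odd (m + 1) := by
        change Odd (pathG m).order ↔ _
        rw [pathG_order]
      rw [hmem] at hyes hno
      refine ⟨hyes, fun h' => ?_⟩
      by_contra hodd
      rw [hno hodd] at h'
      simp at h'
  choose z a hwalk using key
  refine not_forall_end_kind (w₀ := nodeWord A endKind) (w₁ := nodeWord A innerKind)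
    (w₂ := nodeWord A startKind) ?_ ?_ z a (fun m hm => (hwalk m hm).1)
    (fun m hm => (hwalk m hm).2.1) ?_
  · intro t
    unfold nodeWord
    cases nodeStep A endKind.1 (nodeSeq A endKind t) <;> simp [isUp]
  · intro t
    unfold nodeWord
    cases nodeStep A startKind.1 (nodeSeq A startKind t) <;> simp [isUp]
  · intro m m' hm hm' h₀ h₁
    obtain ⟨hw, hn, r, hr, hodd⟩ := hwalk m hm
    obtain ⟨hw', hn', r', hr', hodd'⟩ := hwalk m' hm'
    have hp := hw.proper _ hw.le
    have hp' := hw'.proper _ hw'.le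
    rw [agentWords_eq] at hn hn' hp hp'
    rw [kind_eq_iff hm hm' h₀ h₁] at hn hp hr
    -- Both numbers are the index of the first `none` in the same word.
    have ha : a m (z m) = a m' (z m') := by
      rcases lt_trichotomy (a m (z m)) (a m' (z m')) with hlt | heq | hlt
      · exact absurd hn (hp' _ hlt)
      · exact heq
      · exact absurd hn' (hp _ hlt)
    rw [ha] at hr
    rw [hodd, hodd', hr.unique hr']

/-! ### The separation -/

theorem PAGT_zero_subset (h : ℕ → ℕ) : PAGT (fun _ => 0) h ⊆ PAGT (fun _ => 1) h := by
  rintro T ⟨A, h₁, h₂, h₃, h₄⟩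
  refine ⟨A, h₁, h₂, fun n G hn v k c hc t => ?_, h₄⟩
  obtain ⟨-, hout, hlo, hhi⟩ := h₃ n G hn v k c hc t
  refine ⟨fun i hi _ => ?_, fun i _ => hout i (lt_or_ge i 0), hlo, hhi.trans (by simp)⟩
  rw [hout i (Or.inr hi)]
  simp [zeroTape, hi]

end MobileAgent

theorem theorem2 :
    MobileAgent.Parity ∈ MobileAgent.PAGTTheta (fun _ => 1) (fun _ => 1) ∧
    MobileAgent.Parity ∉ MobileAgent.PAGTTheta (fun _ => 0) (fun _ => 1) ∧
    MobileAgent.PAGTTheta (fun _ => 0) (fun _ => 1) ⊂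
      MobileAgent.PAGTTheta (fun _ => 1) (fun _ => 1) := by
  have hnot : MobileAgent.Parity ∉ MobileAgent.PAGTTheta (fun _ => 0) (fun _ => 1) := by
    intro h
    obtain ⟨h', -, hmem⟩ := Set.mem_iUnion₂.1 h
    exact MobileAgent.parity_notMem_PAGT h' hmem
  refine ⟨MobileAgent.parity_mem, hnot, ?_, fun h => hnot (h MobileAgent.parity_mem)⟩
  exact Set.iUnion₂_mono fun h' _ => MobileAgent.PAGT_zero_subset h'
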